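/- Let $\gamma>0$ and $0\le\alpha<1$. For $\nu\in\mathbb C$ put $F_\nu={}_2F_1(\gamma,\nu\gamma;1+\nu\gamma;\alpha)$, and let $$g(x)=g(x;\gamma,\alpha)=\sum_{l=0}^{\infty}\frac{(-x)^l}{l!}\,\frac{1}{\prod_{j=0}^{l}F_j}.$$ Let $h(x)=h(x;\gamma,\alpha)$ be a density on $(0,\infty)$, i.e. $h\ge 0$ and $\int_0^\infty h(x)\,dx=1$, that solves $$h(x)=\frac{\gamma}{x}\int_0^x\frac{h(u)}{(x-\alpha u)^{\gamma}}\,du\qquad(x>0).$$ The infinite product $\prod_{j\ge1}F_{j-t}/F_j$ converges for $\Re(t)<1+\gamma^{-1}$, the series $g$ converges for all complex $x$, and the following hold, all integrals being absolutely convergent. (i) For every $x>0$ and every real $c$ with $0<c<1+\gamma^{-1}$, $$g(x)=\frac{1}{2\pi i}\int_{c-i\infty}^{c+i\infty}x^{-t}\,\Gamma(t)\,(1-\alpha)^{-\gamma t}\prod_{j=1}^{\infty}\frac{{}_2F_1(\gamma,(j-t)\gamma;1+(j-t)\gamma;\alpha)}{{}_2F_1(\gamma,j\gamma;1+j\gamma;\alpha)}\,dt.$$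 (ii) For every $x>0$ and every real $c<1$, $$h(x)=\frac{\gamma}{2\pi i x}\int_{c-i\infty}^{c+i\infty}x^{-\gamma t}\,\Gamma(1-t)\,(1-\alpha)^{-\gamma t}\prod_{j=1}^{\infty}\frac{{}_2F_1(\gamma,(j-t)\gamma;1+(j-t)\gamma;\alpha)}{{}_2F_1(\gamma,j\gamma;1+j\gamma;\alpha)}\,dt.$$ (iii) For every complex $s$ with $\Re(s)<1+\gamma$, the Mellin transform $H(s)=\int_0^\infty x^{s-1}h(x)\,dx$ converges absolutely, the product below converges, and $$H(s)=(1-\alpha)^{1-s}\,\Gamma\!\left(\frac{1+\gamma-s}{\gamma}\right)\prod_{j=1}^{\infty}\frac{{}_2F_1(\gamma,1-s+j\gamma;2-s+j\gamma;\alpha)}{{}_2F_1(\gamma,j\gamma;1+j\gamma;\alpha)}.$$ -/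

import Mathlib

open MeasureTheory Complex

noncomputable section

namespace AlphaSun

/-- `F γ α ν = ₂F₁(γ, νγ; 1 + νγ; α)`, for a complex index `ν`. -/
def F (γ α : ℝ) (ν : ℂ) : ℂ :=
  ordinaryHypergeometric (γ : ℂ) (ν * γ) (1 + ν * γ) (α : ℂ)

/-- The terms of the power series of the generating function. -/
def gTerm (γ α : ℝ) (x : ℂ) (l : ℕ) : ℂ :=
  (-x) ^ l / ((l.factorial : ℂ) * ∏ j ∈ Finset.range (l + 1), F γ α (j : ℂ))

/-- The generating function `g(x) = ∑ (-x)^l / (l! ∏_{j=0}^l F_j)`. -/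
def g (γ α : ℝ) (x : ℂ) : ℂ := ∑' l : ℕ, gTerm γ α x l

/-- The factor of index `j + 1` (`j = 0, 1, 2, …`) of the infinite product
`∏_{j ≥ 1} F_{j - t} / F_j`. -/
def ratio (γ α : ℝ) (t : ℂ) (j : ℕ) : ℂ :=
  F γ α (((j : ℂ) + 1) - t) / F γ α ((j : ℂ) + 1)

/-- The factor of index `j + 1` (`j = 0, 1, 2, …`) of the infinite product
`∏_{j ≥ 1} ₂F₁(γ, 1 - s + jγ; 2 - s + jγ; α) / F_j`. -/
def ratioH (γ α : ℝ) (s : ℂ) (j : ℕ) : ℂ :=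
  ordinaryHypergeometric (γ : ℂ) (1 - s + ((j : ℂ) + 1) * γ) (2 - s + ((j : ℂ) + 1) * γ) (α : ℂ) /
    F γ α ((j : ℂ) + 1)

/-- The Mellin–Barnes integrand of the generating function. -/
def gIntegrand (γ α x : ℝ) (t : ℂ) : ℂ :=
  (x : ℂ) ^ (-t) * Complex.Gamma t * ((1 - α : ℝ) : ℂ) ^ (-(γ * t)) * ∏' j : ℕ, ratio γ α t j

/-- The Mellin–Barnes integrand of the density. -/
def hIntegrand (γ α x : ℝ) (t : ℂ) : ℂ :=
  (x : ℂ) ^ (-(γ * t)) * Complex.Gamma (1 - t) * ((1 - α : ℝ) : ℂ) ^ (-(γ * t)) *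
    ∏' j : ℕ, ratio γ α t j

/-- The contour integral `∫_{c - i∞}^{c + i∞} f(t) dt` along the upward vertical line `Re t = c`. -/
def lineIntegral (c : ℝ) (f : ℂ → ℂ) : ℂ := ∫ y : ℝ, f (c + y * I) * I

/-- `h` is a real normalised density on `(0, ∞)` that solves the integral equation
`h(x) = (γ / x) ∫_0^x h(u) / (x - α u)^γ du`. -/
structure IsDensity (γ α : ℝ) (h : ℝ → ℝ) : Prop where
  nonneg : ∀ x : ℝ, 0 < x → 0 ≤ h x
  integrable : IntegrableOn h (Set.Ioi 0)
  normalised : ∫ x in Set.Ioi (0 : ℝ), h x = 1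
  equation : ∀ x : ℝ, 0 < x → h x = γ / x * ∫ u in (0 : ℝ)..x, h u / (x - α * u) ^ γ

end AlphaSun

end

/-!
Write `hyp γ α w = ₂F₁(γ, w; 1 + w; α)`, so that `F ν = hyp (ν γ)`. Its power series is
`∑ aₙ (1 - n / (w + n))`, where `∑ aₙ = (1 - α)^(-γ)` is the binomial series with nonnegative terms.
This gives all that is needed about `F`: it is holomorphic for `Re w > -1`, has real part at least
`1` on the right half-plane (`one_le_norm_hyp`), and differs from `(1 - α)^(-γ)` by `O(1 / Re w)`.
Hence the product `∏ F_{j - t} / F_j` converges, and multiplying it by `(1 - α)^(-γ t)` gives a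
function `growthFactor` that satisfies `A(t) = A(t - 1) F_{1 - t}` (`growthFactor_eq`), because the
product telescopes and the limit of `Fₙ` is absorbed by the power. This function has polynomial
growth on vertical strips, so that a Gamma factor makes every integral in the theorem converge
absolutely (`exists_norm_Gamma_mul_growthFactor_le`).

*The generating function.* The integrand `x^(-t) Γ(t) A(t)` has simple poles at `0, -1, -2, …`, and
by the functional equations of `Γ` and `A` the residue at `-k` is the `k`-th term of the series
`g(x)` (`integral_line_shiftedIntegrand_sub`). After the line of integration has been moved past the
first `k` poles the remaining integral is `O(x^k / k!)`
(`tendsto_integral_line_shiftedIntegrand`).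

*The density.* Rescaled to the unit interval, the integral equation reads
`h(x) = γ x^(-γ) ∫₀¹ h(x v) (1 - α v)^(-γ) dv`. By Tonelli's theorem convergence of the Mellin
transform propagates by steps of `γ` in both directions, and Fubini's theorem together with Euler's
integral for `hyp` gives the functional equation `(z + 1) W(z) = F_{z + 1} W(z + 1)` for the moments
`W(z) = H(1 - γ z) = E[(X^(-γ))^z]` (`moment_recurrence`). Together with `W(0) = 1` it determines
the moments of natural order, but a periodic factor still has to be excluded. This is done by
concentration: under the measure with density proportional to `x^(-γ n) h(x)` the variable `X^(-γ)`
has mean `mₙ = W(n + 1) / W(n)` and relative variance `mₙ₊₁ / mₙ - 1`, which tends to `0`, so that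
`W(n + z) ~ W(n) mₙ^z` for `0 ≤ Re z ≤ 1` (`tendsto_moment_div`). Running the recurrence from `z` to
`z + n` and letting `n` tend to infinity, Euler's limit formula for `Γ` yields
`W(z) = Γ(z + 1) A(-z)` (`moment_eq`), which is the Mellin transform. The formula for `h` is then
Mellin inversion, `h` being continuous by dominated convergence in its integral equation.
-/

open MeasureTheory Complex

noncomputable section

namespace AlphaSun

open Filter Topology

/-! ### The hypergeometric factor -/

/-- The coefficients `(γ)_n α^n / n!` of the binomial series of `(1 - α)^{-γ}`. -/
def coeff (γ α : ℝ) (n : ℕ) : ℝ := (ascPochhammer ℝ n).eval γ / n.factorial * α ^ n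

/-- `hyp γ α w = ₂F₁(γ, w; 1 + w; α)`, so that `F γ α ν = hyp γ α (ν γ)`. -/
def hyp (γ α : ℝ) (w : ℂ) : ℂ := ordinaryHypergeometric (γ : ℂ) w (1 + w) (α : ℂ)

lemma F_eq_hyp (γ α : ℝ) (ν : ℂ) : F γ α ν = hyp γ α (ν * γ) := rfl

lemma coeff_zero (γ α : ℝ) : coeff γ α 0 = 1 := by simp [coeff]

lemma coeff_nonneg {γ α : ℝ} (hγ : 0 < γ) (hα0 : 0 ≤ α) (n : ℕ) : 0 ≤ coeff γ α n := by
  have : 0 < (ascPochhammer ℝ n).eval γ := ascPochhammer_pos n γ hγ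
  unfold coeff; positivity

/-- The binomial series. -/
lemma hasSum_coeff_mul_pow {γ α : ℝ} (hα0 : 0 ≤ α) (hα1 : α < 1) {v : ℝ} (hv0 : 0 ≤ v)
    (hv1 : v ≤ 1) : HasSum (fun n ↦ coeff γ α n * v ^ n) ((1 - α * v) ^ (-γ)) := by
  have hlt : α * v < 1 := by nlinarith
  have h := (Real.one_div_one_sub_rpow_hasFPowerSeriesOnBall_zero γ).hasSum
    (y := α * v) (by
      rw [Metric.mem_eball, edist_zero_right, Real.enorm_of_nonneg (mul_nonneg hα0 hv0)]
      exact ENNReal.ofReal_lt_one.2 hlt)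
  rw [zero_add, one_div, ← Real.rpow_neg (by linarith)] at h
  refine h.congr_fun fun n ↦ ?_
  have hf := Ring.factorial_nsmul_multichoose_eq_ascPochhammer γ n
  rw [Polynomial.ascPochhammer_smeval_eq_eval, nsmul_eq_mul] at hf
  rw [FormalMultilinearSeries.ofScalars_apply_eq, smul_eq_mul, mul_pow, coeff, Ring.choose,
    ← hf, show γ + n - 1 - n + 1 = γ by ring,
    mul_div_cancel_left₀ _ (Nat.cast_ne_zero.2 n.factorial_ne_zero), mul_assoc]

lemma hasSum_coeff {γ α : ℝ} (hα0 : 0 ≤ α) (hα1 : α < 1) :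
    HasSum (coeff γ α) ((1 - α) ^ (-γ)) := by
  simpa using hasSum_coeff_mul_pow (γ := γ) hα0 hα1 zero_le_one le_rfl

lemma succ_mul_coeff_succ (γ α : ℝ) (n : ℕ) :
    ((n + 1 : ℕ) : ℝ) * coeff γ α (n + 1) = γ * α * coeff (γ + 1) α n := by
  simp only [coeff, ascPochhammer_succ_left, Polynomial.eval_mul, Polynomial.eval_X,
    Polynomial.eval_comp, Polynomial.eval_add, Polynomial.eval_one, Nat.factorial_succ]
  push_cast
  field_simp
  ring

/-- The sum `∑ n a_n` of the weighted coefficients. -/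
def slope (γ α : ℝ) : ℝ := γ * α * (1 - α) ^ (-(γ + 1))

lemma hasSum_nat_mul_coeff {γ α : ℝ} (hα0 : 0 ≤ α) (hα1 : α < 1) :
    HasSum (fun n : ℕ ↦ (n : ℝ) * coeff γ α n) (slope γ α) := by
  rw [← hasSum_nat_add_iff' 1]
  simp only [succ_mul_coeff_succ]
  simpa [slope] using (hasSum_coeff (γ := γ + 1) hα0 hα1).mul_left (γ * α)

lemma slope_nonneg {γ α : ℝ} (hγ : 0 < γ) (hα0 : 0 ≤ α) (hα1 : α < 1) : 0 ≤ slope γ α := by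
  have : 0 < 1 - α := by linarith
  unfold slope; positivity

lemma add_natCast_ne_zero {w : ℂ} (hw : -1 < w.re) {n : ℕ} (hn : n ≠ 0) : w + n ≠ 0 := by
  intro h
  have := congrArg re h
  have h1 : (1 : ℝ) ≤ n := by exact_mod_cast Nat.one_le_iff_ne_zero.2 hn
  simp at this
  linarith

lemma ascPochhammer_eval_ratio {w : ℂ} (hw : -1 < w.re) (n : ℕ) :
    (ascPochhammer ℂ n).eval w * ((ascPochhammer ℂ n).eval (1 + w))⁻¹ = 1 - n / (w + n) := by
  have hne : ∀ m : ℕ, (ascPochhammer ℂ m).eval (1 + w) ≠ 0 := by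
    intro m
    induction m with
    | zero => simp
    | succ m ih =>
      rw [ascPochhammer_succ_eval]
      have := add_natCast_ne_zero hw (n := m + 1) (by simp)
      push_cast at this
      exact mul_ne_zero ih (by convert this using 1; ring)
  induction n with
  | zero => simp
  | succ n ih =>
    have h1 := add_natCast_ne_zero hw (n := n + 1) (by simp)
    have h2 : 1 + w + (n : ℂ) ≠ 0 := by
      push_cast at h1; convert h1 using 1; ring
    rw [ascPochhammer_succ_eval, ascPochhammer_succ_eval]
    rcases eq_or_ne n 0 with rfl | hn
    · simp at h1 h2 ⊢
      field_simp
      ring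
    · have h3 := add_natCast_ne_zero hw hn
      calc _ = (ascPochhammer ℂ n).eval w * ((ascPochhammer ℂ n).eval (1 + w))⁻¹ *
            ((w + n) * (1 + w + n)⁻¹) := by rw [mul_inv]; ring
        _ = _ := by
            rw [ih]; push_cast at h1 ⊢; field_simp; ring

/-- The partial-fraction weight `1 - n / (w + n)` is bounded on `Re w ≥ -1 + δ`. -/
lemma norm_one_sub_div_le {δ : ℝ} (hδ : 0 < δ) (hδ1 : δ ≤ 1) {w : ℂ} (hw : -1 + δ ≤ w.re)
    (n : ℕ) : ‖1 - (n : ℂ) / (w + n)‖ ≤ 1 + 1 / δ := by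
  refine (norm_sub_le _ _).trans ?_
  rw [norm_one]
  gcongr
  rcases eq_or_ne n 0 with rfl | hn
  · simp; positivity
  have h1 : (1 : ℝ) ≤ n := by exact_mod_cast Nat.one_le_iff_ne_zero.2 hn
  have h2 : (n : ℝ) - 1 + δ ≤ ‖w + n‖ := by
    refine le_trans ?_ (re_le_norm _); simp; linarith
  rw [norm_div, norm_natCast, div_le_div_iff₀ (by linarith) hδ]
  nlinarith

/-- The hypergeometric series, with `(w)_n / (1 + w)_n` written as `1 - n / (w + n)`. -/
lemma hasSum_hyp {γ α : ℝ} (hγ : 0 < γ) (hα0 : 0 ≤ α) (hα1 : α < 1) {w : ℂ} (hw : -1 < w.re) :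
    HasSum (fun n : ℕ ↦ (coeff γ α n : ℂ) * (1 - n / (w + n))) (hyp γ α w) := by
  have hs : Summable (fun n : ℕ ↦ (coeff γ α n : ℂ) * (1 - n / (w + n))) := by
    obtain ⟨δ, hδ, hδ1, hδw⟩ : ∃ δ : ℝ, 0 < δ ∧ δ ≤ 1 ∧ -1 + δ ≤ w.re :=
      ⟨min 1 (w.re + 1), by simp; linarith, min_le_left _ _, by
        linarith [min_le_right 1 (w.re + 1)]⟩
    refine Summable.of_norm_bounded
      ((hasSum_coeff (γ := γ) hα0 hα1).summable.mul_right (1 + 1 / δ)) fun n ↦ ?_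
    rw [norm_mul, norm_real, Real.norm_of_nonneg (coeff_nonneg hγ hα0 n)]
    exact mul_le_mul_of_nonneg_left (norm_one_sub_div_le hδ hδ1 hδw n) (coeff_nonneg hγ hα0 n)
  convert hs.hasSum using 1
  rw [hyp, ordinaryHypergeometric_eq_tsum]
  refine tsum_congr fun n ↦ ?_
  rw [← ascPochhammer_eval_ratio hw, coeff, smul_eq_mul]
  have : (ascPochhammer ℂ n).eval (γ : ℂ) = (((ascPochhammer ℝ n).eval γ : ℝ) : ℂ) := by
    rw [← ascPochhammer_map (algebraMap ℝ ℂ), ← Complex.coe_algebraMap,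
      Polynomial.eval_map_algebraMap, Polynomial.aeval_algebraMap_apply, Polynomial.coe_aeval_eq_eval]
  rw [this]
  push_cast
  ring

lemma hyp_zero {γ α : ℝ} (hγ : 0 < γ) (hα0 : 0 ≤ α) (hα1 : α < 1) : hyp γ α 0 = 1 := by
  refine (hasSum_hyp hγ hα0 hα1 (w := 0) (by simp)).unique ?_
  convert hasSum_single (f := fun n : ℕ ↦ (coeff γ α n : ℂ) * (1 - n / (0 + n))) 0 ?_ using 1
  · simp [coeff_zero]
  · intro n hn
    have : (n : ℂ) ≠ 0 := by exact_mod_cast hn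
    simp [this]

lemma one_sub_div_re_nonneg {w : ℂ} (hw : 0 ≤ w.re) (n : ℕ) :
    0 ≤ (1 - (n : ℂ) / (w + n)).re := by
  rcases eq_or_ne n 0 with rfl | hn
  · simp
  have h1 : (1 : ℝ) ≤ n := by exact_mod_cast Nat.one_le_iff_ne_zero.2 hn
  have h2 : (0 : ℝ) < ‖w + n‖ := norm_pos_iff.2 (add_natCast_ne_zero (by linarith) hn)
  have h3 : (n : ℝ) ≤ ‖w + n‖ := by
    refine le_trans ?_ (re_le_norm _); simp; linarith
  have h4 : ((n : ℂ) / (w + n)).re ≤ 1 := by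
    refine (re_le_norm _).trans ?_
    rw [norm_div, norm_natCast]
    exact (div_le_one h2).2 h3
  simp only [sub_re, one_re]; linarith

/-- On the right half-plane every term of the series has nonnegative real part and the term of
index `0` is `1`; in particular `hyp` has no zeros there. -/
lemma one_le_norm_hyp {γ α : ℝ} (hγ : 0 < γ) (hα0 : 0 ≤ α) (hα1 : α < 1) {w : ℂ}
    (hw : 0 ≤ w.re) : 1 ≤ ‖hyp γ α w‖ := by
  refine le_trans ?_ (re_le_norm _)
  have h := hasSum_re (hasSum_hyp hγ hα0 hα1 (w := w) (by linarith))
  have h0 := le_hasSum h 0 fun n _ ↦ by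
    rw [re_ofReal_mul]
    exact mul_nonneg (coeff_nonneg hγ hα0 n) (one_sub_div_re_nonneg hw n)
  simpa [coeff_zero] using h0

lemma hyp_ne_zero {γ α : ℝ} (hγ : 0 < γ) (hα0 : 0 ≤ α) (hα1 : α < 1) {w : ℂ}
    (hw : 0 ≤ w.re) : hyp γ α w ≠ 0 := by
  rw [← norm_pos_iff]; linarith [one_le_norm_hyp hγ hα0 hα1 hw]

lemma norm_hyp_le {γ α : ℝ} (hγ : 0 < γ) (hα0 : 0 ≤ α) (hα1 : α < 1) {δ : ℝ} (hδ : 0 < δ)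
    (hδ1 : δ ≤ 1) {w : ℂ} (hw : -1 + δ ≤ w.re) :
    ‖hyp γ α w‖ ≤ (1 - α) ^ (-γ) * (1 + 1 / δ) := by
  have h := hasSum_hyp hγ hα0 hα1 (w := w) (by linarith)
  rw [← h.tsum_eq]
  refine tsum_of_norm_bounded ((hasSum_coeff (γ := γ) hα0 hα1).mul_right (1 + 1 / δ)) fun n ↦ ?_
  rw [norm_mul, norm_real, Real.norm_of_nonneg (coeff_nonneg hγ hα0 n)]
  exact mul_le_mul_of_nonneg_left (norm_one_sub_div_le hδ hδ1 hw n) (coeff_nonneg hγ hα0 n)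

/-- The distance of `hyp` to its limit `(1 - α)^{-γ}` at infinity. -/
lemma norm_hyp_sub_const_le {γ α : ℝ} (hγ : 0 < γ) (hα0 : 0 ≤ α) (hα1 : α < 1) {r : ℝ}
    (hr : 0 < r) {w : ℂ} (hw : r ≤ w.re) :
    ‖hyp γ α w - ((1 - α) ^ (-γ) : ℝ)‖ ≤ slope γ α / r := by
  have h := (hasSum_hyp hγ hα0 hα1 (w := w) (by linarith)).sub
    (hasSum_ofReal.2 (hasSum_coeff (γ := γ) hα0 hα1))
  rw [← h.tsum_eq]
  refine tsum_of_norm_bounded ((hasSum_nat_mul_coeff (γ := γ) hα0 hα1).div_const r) fun n ↦ ?_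
  have h2 : r ≤ ‖w + n‖ := by
    refine le_trans ?_ (re_le_norm _); simp; linarith [Nat.cast_nonneg (α := ℝ) n]
  have : (coeff γ α n : ℂ) * (1 - n / (w + n)) - (coeff γ α n : ℂ) =
      -(coeff γ α n * n / (w + n)) := by ring
  rw [this, norm_neg, norm_div, norm_mul, norm_real, norm_natCast,
    Real.norm_of_nonneg (coeff_nonneg hγ hα0 n), mul_comm]
  gcongr
  exact mul_nonneg n.cast_nonneg (coeff_nonneg hγ hα0 n)

lemma norm_hyp_sub_hyp_le {γ α : ℝ} (hγ : 0 < γ) (hα0 : 0 ≤ α) (hα1 : α < 1) {r r' : ℝ}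
    (hr : 0 < r) (hr' : 0 < r') {w w' : ℂ} (hw : r ≤ w.re) (hw' : r' ≤ w'.re) :
    ‖hyp γ α w - hyp γ α w'‖ ≤ slope γ α * ‖w - w'‖ / (r * r') := by
  have h := (hasSum_hyp hγ hα0 hα1 (w := w) (by linarith)).sub
    (hasSum_hyp hγ hα0 hα1 (w := w') (by linarith))
  rw [← h.tsum_eq]
  refine tsum_of_norm_bounded (((hasSum_nat_mul_coeff (γ := γ) hα0 hα1).mul_right
    ‖w - w'‖).div_const (r * r')) fun n ↦ ?_
  have hn := Nat.cast_nonneg (α := ℝ) n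
  have h2 : r ≤ ‖w + n‖ := by
    refine le_trans ?_ (re_le_norm _); simp; linarith
  have h3 : r' ≤ ‖w' + n‖ := by
    refine le_trans ?_ (re_le_norm _); simp; linarith
  have h4 : w + n ≠ 0 := norm_pos_iff.1 (by linarith)
  have h5 : w' + n ≠ 0 := norm_pos_iff.1 (by linarith)
  have : (coeff γ α n : ℂ) * (1 - n / (w + n)) - (coeff γ α n : ℂ) * (1 - n / (w' + n)) =
      n * coeff γ α n * (w - w') / ((w + n) * (w' + n)) := by field_simp; ring
  rw [this, norm_div, norm_mul, norm_mul, norm_mul, norm_real, norm_natCast,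
    Real.norm_of_nonneg (coeff_nonneg hγ hα0 n)]
  gcongr
  exact mul_nonneg (mul_nonneg n.cast_nonneg (coeff_nonneg hγ hα0 n)) (norm_nonneg _)

lemma differentiableOn_hyp {γ α : ℝ} (hγ : 0 < γ) (hα0 : 0 ≤ α) (hα1 : α < 1) :
    DifferentiableOn ℂ (hyp γ α) {w | -1 < w.re} := by
  intro w₀ hw₀
  obtain ⟨δ, hδ, hδ1, hδw⟩ : ∃ δ : ℝ, 0 < δ ∧ δ ≤ 1 ∧ -1 + δ < w₀.re :=
    ⟨min 1 ((w₀.re + 1) / 2), by simp at hw₀ ⊢; linarith, min_le_left _ _, by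
      have := min_le_right 1 ((w₀.re + 1) / 2); simp at hw₀; linarith⟩
  have ho : IsOpen {w : ℂ | -1 + δ < w.re} := isOpen_lt continuous_const continuous_re
  have hd : DifferentiableOn ℂ (fun w ↦ ∑' n : ℕ, (coeff γ α n : ℂ) * (1 - n / (w + n)))
      {w : ℂ | -1 + δ < w.re} := by
    refine differentiableOn_tsum_of_summable_norm
      ((hasSum_coeff (γ := γ) hα0 hα1).summable.mul_right (1 + 1 / δ)) ?_ ho ?_
    · intro n w hw
      rcases eq_or_ne n 0 with rfl | hn
      · simp [differentiableWithinAt_const]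
      have : w + n ≠ 0 := add_natCast_ne_zero (by simp at hw; linarith) hn
      fun_prop (disch := assumption)
    · intro n w hw
      rw [norm_mul, norm_real, Real.norm_of_nonneg (coeff_nonneg hγ hα0 n)]
      exact mul_le_mul_of_nonneg_left (norm_one_sub_div_le hδ hδ1 (le_of_lt hw) n)
        (coeff_nonneg hγ hα0 n)
  have hd' : DifferentiableOn ℂ (hyp γ α) {w : ℂ | -1 + δ < w.re} :=
    hd.congr fun w hw ↦ ((hasSum_hyp hγ hα0 hα1 (by simp at hw; linarith)).tsum_eq).symm
  exact (hd'.differentiableAt (ho.mem_nhds hδw)).differentiableWithinAt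

/-- The Euler integral of `₂F₁(γ, w; 1 + w; α)`. -/
lemma integral_cpow_mul_one_sub_rpow {γ α : ℝ} (hγ : 0 < γ) (hα0 : 0 ≤ α) (hα1 : α < 1) {w : ℂ}
    (hw : 0 < w.re) :
    ∫ v in Set.Ioc (0 : ℝ) 1, (v : ℂ) ^ (w - 1) * (((1 - α * v) ^ (-γ) : ℝ) : ℂ) =
      hyp γ α w / w := by
  have hw0 : w ≠ 0 := fun h ↦ by simp [h] at hw
  have hmono : ∀ (u : ℂ) (_ : 0 < u.re),
      IntegrableOn (fun v : ℝ ↦ (v : ℂ) ^ (u - 1)) (Set.Ioc 0 1) ∧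
      ∫ v in Set.Ioc (0 : ℝ) 1, (v : ℂ) ^ (u - 1) = 1 / u := by
    intro u hu
    have hu0 : u ≠ 0 := fun h ↦ by simp [h] at hu
    have hi := intervalIntegral.intervalIntegrable_cpow' (a := 0) (b := 1) (r := u - 1)
      (by simp; linarith)
    refine ⟨(intervalIntegrable_iff_integrableOn_Ioc_of_le zero_le_one).1 hi, ?_⟩
    rw [← intervalIntegral.integral_of_le zero_le_one, integral_cpow (Or.inl (by simp; linarith))]
    simp [hu0]
  have hpow : ∀ (n : ℕ) (v : ℝ), v ∈ Set.Ioc (0 : ℝ) 1 →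
      (v : ℂ) ^ (w - 1) * ((coeff γ α n * v ^ n : ℝ) : ℂ) =
        coeff γ α n * (v : ℂ) ^ (w + n - 1) := by
    intro n v hv
    have hv0 : (v : ℂ) ≠ 0 := by exact_mod_cast hv.1.ne'
    rw [show w + n - 1 = (w - 1) + n by ring, cpow_add _ _ hv0, cpow_natCast]
    push_cast; ring
  have hre : ∀ n : ℕ, 0 < (w + n).re := fun n ↦ by simp; positivity
  have hint : ∀ n : ℕ, Integrable
      (fun v : ℝ ↦ (v : ℂ) ^ (w - 1) * ((coeff γ α n * v ^ n : ℝ) : ℂ))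
      (volume.restrict (Set.Ioc (0 : ℝ) 1)) := fun n ↦
    ((hmono (w + n) (hre n)).1.const_mul (coeff γ α n : ℂ)).congr
      ((ae_restrict_mem measurableSet_Ioc).mono fun v hv ↦ (hpow n v hv).symm)
  have hnorm : ∀ n : ℕ, ∫ v in Set.Ioc (0 : ℝ) 1,
      ‖(v : ℂ) ^ (w - 1) * ((coeff γ α n * v ^ n : ℝ) : ℂ)‖ ≤
        coeff γ α n * ∫ v in Set.Ioc (0 : ℝ) 1, ‖(v : ℂ) ^ (w - 1)‖ := by
    intro n
    rw [← integral_const_mul]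
    refine setIntegral_mono_on (hint n).norm ((hmono w hw).1.norm.const_mul _)
      measurableSet_Ioc fun v hv ↦ ?_
    rw [norm_mul, norm_real, Real.norm_of_nonneg (mul_nonneg (coeff_nonneg hγ hα0 n)
      (pow_nonneg hv.1.le n)), mul_comm]
    gcongr
    exact mul_le_of_le_one_right (coeff_nonneg hγ hα0 n) (pow_le_one₀ hv.1.le hv.2)
  have hsum := hasSum_integral_of_summable_integral_norm hint
    (Summable.of_nonneg_of_le (fun n ↦ by positivity) hnorm
      ((hasSum_coeff (γ := γ) hα0 hα1).summable.mul_right _))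
  have h1 : ∫ v in Set.Ioc (0 : ℝ) 1,
      ∑' n : ℕ, (v : ℂ) ^ (w - 1) * ((coeff γ α n * v ^ n : ℝ) : ℂ) =
      ∫ v in Set.Ioc (0 : ℝ) 1, (v : ℂ) ^ (w - 1) * (((1 - α * v) ^ (-γ) : ℝ) : ℂ) := by
    refine setIntegral_congr_fun measurableSet_Ioc fun v hv ↦ ?_
    exact ((hasSum_ofReal.2 (hasSum_coeff_mul_pow hα0 hα1 hv.1.le hv.2)).mul_left _).tsum_eq
  rw [h1] at hsum
  refine hsum.unique ?_
  refine ((hasSum_hyp hγ hα0 hα1 (w := w) (by linarith)).div_const w).congr_fun fun n ↦ ?_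
  rw [setIntegral_congr_fun measurableSet_Ioc (hpow n), integral_const_mul,
    (hmono (w + n) (hre n)).2]
  have : w + n ≠ 0 := fun h ↦ by have := hre n; simp [h] at this
  field_simp
  ring

/-! ### The infinite product and its growth -/

lemma norm_F_natCast_ge {γ α : ℝ} (hγ : 0 < γ) (hα0 : 0 ≤ α) (hα1 : α < 1) (j : ℕ) :
    1 ≤ ‖F γ α (j : ℂ)‖ := by
  rw [F_eq_hyp]
  exact one_le_norm_hyp hγ hα0 hα1 (by simp; positivity)

lemma F_ne_zero {γ α : ℝ} (hγ : 0 < γ) (hα0 : 0 ≤ α) (hα1 : α < 1) {ν : ℂ} (hν : 0 ≤ ν.re) :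
    F γ α ν ≠ 0 := by
  rw [F_eq_hyp]
  exact hyp_ne_zero hγ hα0 hα1 (by simp; positivity)

lemma F_zero {γ α : ℝ} (hγ : 0 < γ) (hα0 : 0 ≤ α) (hα1 : α < 1) : F γ α 0 = 1 := by
  rw [F_eq_hyp, zero_mul, hyp_zero hγ hα0 hα1]

lemma differentiableOn_F {γ α : ℝ} (hγ : 0 < γ) (hα0 : 0 ≤ α) (hα1 : α < 1) :
    DifferentiableOn ℂ (F γ α) {ν | -(1 / γ) < ν.re} := by
  refine (differentiableOn_hyp hγ hα0 hα1).comp (f := fun ν : ℂ ↦ ν * γ) (by fun_prop) ?_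
  intro ν hν
  simp only [Set.mem_ofPred_eq, mul_re, ofReal_re, ofReal_im, mul_zero, sub_zero] at hν ⊢
  have := mul_lt_mul_of_pos_right hν hγ
  field_simp at this
  linarith

lemma tendsto_F_natCast_add {γ α : ℝ} (hγ : 0 < γ) (hα0 : 0 ≤ α) (hα1 : α < 1) (z : ℂ) :
    Tendsto (fun n : ℕ ↦ F γ α (n + z)) atTop (𝓝 (((1 - α) ^ (-γ) : ℝ) : ℂ)) := by
  rw [tendsto_iff_norm_sub_tendsto_zero]
  have hlim : Tendsto (fun n : ℕ ↦ slope γ α / (((n : ℝ) + z.re) * γ)) atTop (𝓝 0) :=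
    Tendsto.div_atTop tendsto_const_nhds
      ((tendsto_atTop_add_const_right _ _ tendsto_natCast_atTop_atTop).atTop_mul_const hγ)
  have hpos : ∀ᶠ n : ℕ in atTop, 0 < (n : ℝ) + z.re :=
    (tendsto_atTop_add_const_right _ _ tendsto_natCast_atTop_atTop).eventually_gt_atTop 0
  refine squeeze_zero' (Eventually.of_forall fun _ ↦ norm_nonneg _) ?_ hlim
  filter_upwards [hpos] with n hn
  exact norm_hyp_sub_const_le hγ hα0 hα1 (by positivity) (by simp)

lemma norm_ratio_sub_one_le {γ α : ℝ} (hγ : 0 < γ) (hα0 : 0 ≤ α) (hα1 : α < 1) (t : ℂ) (j : ℕ) :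
    ‖ratio γ α t j - 1‖ ≤ ‖F γ α ((j : ℂ) + 1 - t) - F γ α ((j : ℂ) + 1)‖ := by
  have h1 := norm_F_natCast_ge hγ hα0 hα1 (j + 1)
  push_cast at h1
  have h0 : F γ α ((j : ℂ) + 1) ≠ 0 := norm_pos_iff.1 (by linarith)
  rw [ratio, div_sub_one h0, norm_div]
  exact div_le_self (norm_nonneg _) h1

/-- The factors of the infinite product are `1 + O(j⁻²)`. -/
lemma norm_ratio_sub_one_le_sq {γ α : ℝ} (hγ : 0 < γ) (hα0 : 0 ≤ α) (hα1 : α < 1) {t : ℂ} {j : ℕ}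
    {r : ℝ} (hr : 0 < r) (hj : r ≤ j + 1 - t.re) :
    ‖ratio γ α t j - 1‖ ≤ slope γ α / γ * ‖t‖ / (r * (j + 1)) := by
  refine (norm_ratio_sub_one_le hγ hα0 hα1 t j).trans ?_
  rw [F_eq_hyp, F_eq_hyp]
  refine (norm_hyp_sub_hyp_le hγ hα0 hα1 (r := r * γ) (r' := (j + 1) * γ) (by positivity)
    (by positivity) ?_ ?_).trans ?_
  · simp; gcongr
  · simp
  · rw [← sub_mul, norm_mul, sub_right_comm, sub_self, zero_sub, norm_neg, norm_real,
      Real.norm_of_nonneg hγ.le]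
    apply le_of_eq
    field_simp

/-- Only the tail of the product matters here, so no bound on `Re t` is needed; finitely many
factors with `Re t ≥ 1 + 1 / γ` may be junk values of the hypergeometric function. -/
lemma multipliable_ratio {γ α : ℝ} (hγ : 0 < γ) (hα0 : 0 ≤ α) (hα1 : α < 1) (t : ℂ) :
    Multipliable (ratio γ α t) := by
  have hs : Summable fun j ↦ ‖ratio γ α t j - 1‖ := by
    have hb : Summable fun j : ℕ ↦ slope γ α / γ * ‖t‖ / (2⁻¹ * ((j : ℝ) + 1) * (j + 1)) := by
      have := (((summable_nat_add_iff 1).2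
        (Real.summable_one_div_nat_pow.2 (le_refl 2))).mul_left (2 * (slope γ α / γ * ‖t‖)))
      refine this.congr fun j ↦ ?_
      push_cast
      field_simp
    refine Summable.of_norm_bounded_eventually_nat hb ?_
    filter_upwards [(tendsto_natCast_atTop_atTop (R := ℝ)).eventually_ge_atTop (2 * t.re)]
      with j hj
    rw [norm_norm]
    exact norm_ratio_sub_one_le_sq hγ hα0 hα1 (by positivity) (by linarith)
  simpa using multipliable_one_add_of_summable hs

/-- `growthFactor γ α t = (1 - α)^{-γ t} ∏_{j ≥ 1} F_{j - t} / F_j`, the factor by which the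
integrands differ from those for `α = 0`. -/
def growthFactor (γ α : ℝ) (t : ℂ) : ℂ :=
  ((1 - α : ℝ) : ℂ) ^ (-(γ * t)) * ∏' j : ℕ, ratio γ α t j

lemma growthFactor_zero {γ α : ℝ} (hγ : 0 < γ) (hα0 : 0 ≤ α) (hα1 : α < 1) :
    growthFactor γ α 0 = 1 := by
  have : ∀ j : ℕ, ratio γ α 0 j = 1 := fun j ↦ by
    have h1 := norm_F_natCast_ge hγ hα0 hα1 (j + 1)
    push_cast at h1
    rw [ratio, sub_zero, div_self (norm_pos_iff.1 (by linarith))]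
  simp [growthFactor, this]

/-- The product telescopes under a unit shift of `t`, and the limit `(1 - α)^{-γ}` of `F_n` is
absorbed by the power of `1 - α`. -/
lemma growthFactor_eq {γ α : ℝ} (hγ : 0 < γ) (hα0 : 0 ≤ α) (hα1 : α < 1) (t : ℂ) :
    growthFactor γ α t = growthFactor γ α (t - 1) * F γ α (1 - t) := by
  have hp : (0 : ℝ) < 1 - α := by linarith
  -- the telescoping identity for the partial products
  have hfin : ∀ n : ℕ, (∏ j ∈ Finset.range n, ratio γ α t j) * F γ α (n + (1 - t)) =
      F γ α (1 - t) * ∏ j ∈ Finset.range n, ratio γ α (t - 1) j := by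
    intro n
    induction n with
    | zero => simp
    | succ n ih =>
      rw [Finset.prod_range_succ, Finset.prod_range_succ, ← mul_assoc, ← ih, ratio, ratio]
      push_cast
      rw [show (n : ℂ) + 1 - (t - 1) = n + 1 + (1 - t) by ring,
        show (n : ℂ) + 1 - t = n + (1 - t) by ring]
      ring
  have h1 := ((multipliable_ratio hγ hα0 hα1 t).hasProd.tendsto_prod_nat.mul
    (tendsto_F_natCast_add hγ hα0 hα1 (1 - t)))
  have h2 := ((multipliable_ratio hγ hα0 hα1 (t - 1)).hasProd.tendsto_prod_nat.const_mul
    (F γ α (1 - t)))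
  have h := tendsto_nhds_unique (h1.congr hfin) h2
  have hpow : ((1 - α : ℝ) : ℂ) ^ (-(γ * t)) =
      ((1 - α : ℝ) : ℂ) ^ (-(γ * (t - 1))) * (((1 - α) ^ (-γ) : ℝ) : ℂ) := by
    rw [ofReal_cpow hp.le, ← cpow_add _ _ (by exact_mod_cast hp.ne')]
    congr 1; push_cast; ring
  rw [growthFactor, growthFactor, hpow, mul_assoc, mul_comm ((((1 - α) ^ (-γ) : ℝ) : ℂ)), h]
  ring

lemma differentiableOn_growthFactor_neg {γ α : ℝ} (hγ : 0 < γ) (hα0 : 0 ≤ α) (hα1 : α < 1) :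
    DifferentiableOn ℂ (growthFactor γ α) {t | t.re < 0} := by
  intro t₀ ht₀
  set U : Set ℂ := {t | t.re < 0} ∩ Metric.ball 0 (‖t₀‖ + 1) with hU
  have hUo : IsOpen U := (isOpen_lt continuous_re continuous_const).inter Metric.isOpen_ball
  have hd : ∀ j, DifferentiableOn ℂ (fun t ↦ ratio γ α t j - 1) U := by
    intro j
    unfold ratio
    refine DifferentiableOn.sub_const (DifferentiableOn.div_const ?_ _) _
    refine (differentiableOn_F hγ hα0 hα1).comp (f := fun t : ℂ ↦ (j : ℂ) + 1 - t)
      (by fun_prop) ?_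
    intro t ht
    have h1 : t.re < 0 := ht.1
    have h2 : 0 < 1 / γ := by positivity
    simp
    have := Nat.cast_nonneg (α := ℝ) j
    rw [one_div] at h2
    linarith
  have hb : Summable fun j : ℕ ↦ slope γ α / γ * (‖t₀‖ + 1) / (((j : ℝ) + 1) * (j + 1)) := by
    have := (((summable_nat_add_iff 1).2
      (Real.summable_one_div_nat_pow.2 (le_refl 2))).mul_left (slope γ α / γ * (‖t₀‖ + 1)))
    refine this.congr fun j ↦ ?_
    push_cast
    field_simp
  have hp := Summable.hasProdLocallyUniformlyOn_nat_one_add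
    (f := fun j t ↦ ratio γ α t j - 1) hUo hb
    (Eventually.of_forall fun j t ht ↦ by
      have h1 : t.re < 0 := ht.1
      have h2 : ‖t‖ < ‖t₀‖ + 1 := by simpa using ht.2
      refine (norm_ratio_sub_one_le_sq hγ hα0 hα1 (r := j + 1) (by positivity)
        (by linarith)).trans ?_
      have := slope_nonneg hγ hα0 hα1
      gcongr) (fun j ↦ (hd j).continuousOn)
  have hp' : DifferentiableOn ℂ (fun t ↦ ∏' j, ratio γ α t j) U := by
    have := hp.tendstoLocallyUniformlyOn_finsetRange.differentiableOn
      (Eventually.of_forall fun n ↦ by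
        refine DifferentiableOn.fun_finsetProd fun j _ ↦ ?_
        exact (hd j).const_add 1) hUo
    simpa using this
  have ht₀U : t₀ ∈ U := ⟨ht₀, by simp⟩
  have hc : DifferentiableAt ℂ (fun t : ℂ ↦ ((1 - α : ℝ) : ℂ) ^ (-(γ * t))) t₀ := by
    refine DifferentiableAt.const_cpow (by fun_prop) (Or.inl ?_)
    have : (1 - α : ℝ) ≠ 0 := by linarith
    exact_mod_cast this
  exact (hc.mul (hp'.differentiableAt (hUo.mem_nhds ht₀U))).differentiableWithinAt

/-- The functional equation carries holomorphy from `Re t < 0` to the right, by unit steps. -/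
lemma differentiableOn_growthFactor {γ α : ℝ} (hγ : 0 < γ) (hα0 : 0 ≤ α) (hα1 : α < 1) :
    DifferentiableOn ℂ (growthFactor γ α) {t | t.re < 1 + 1 / γ} := by
  have hk : ∀ k : ℕ, DifferentiableOn ℂ (growthFactor γ α)
      {t | t.re < 1 + 1 / γ ∧ t.re < k} := by
    intro k
    induction k with
    | zero =>
      exact (differentiableOn_growthFactor_neg hγ hα0 hα1).mono fun t ht ↦ by simpa using ht.2
    | succ k ih =>
      have h1 : DifferentiableOn ℂ (fun t ↦ growthFactor γ α (t - 1) * F γ α (1 - t))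
          {t | t.re < 1 + 1 / γ ∧ t.re < (k + 1 : ℕ)} := by
        refine DifferentiableOn.mul ?_ ?_
        · refine ih.comp (f := fun t : ℂ ↦ t - 1) (by fun_prop) ?_
          rintro t ⟨h1, h2⟩
          push_cast at h2
          simp at h1 ⊢
          constructor <;> linarith
        · refine (differentiableOn_F hγ hα0 hα1).comp (f := fun t : ℂ ↦ 1 - t) (by fun_prop) ?_
          rintro t ⟨h1, h2⟩
          simp at h1 ⊢
          linarith
      exact h1.congr fun t _ ↦ growthFactor_eq hγ hα0 hα1 t
  intro t ht
  obtain ⟨k, hkt⟩ := exists_nat_gt t.re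
  have ho : IsOpen {t : ℂ | t.re < 1 + 1 / γ ∧ t.re < k} :=
    (isOpen_lt continuous_re continuous_const).inter (isOpen_lt continuous_re continuous_const)
  exact ((hk k).differentiableAt (ho.mem_nhds ⟨ht, hkt⟩)).differentiableWithinAt

lemma sum_one_div_sub_one_div_le_harmonic (n N : ℕ) :
    ∑ j ∈ Finset.range n, (1 / ((j : ℝ) + 1) - 1 / ((j : ℝ) + 1 + N)) ≤ harmonic N := by
  have h : ∑ j ∈ Finset.range n, (1 / ((j : ℝ) + 1) - 1 / ((j : ℝ) + 1 + N)) =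
      ∑ j ∈ Finset.range N, (1 / ((j : ℝ) + 1) - 1 / ((j : ℝ) + 1 + n)) := by
    have key : ∀ a b : ℕ, ∑ j ∈ Finset.range a, (1 / ((j : ℝ) + 1) - 1 / ((j : ℝ) + 1 + b)) =
        ∑ j ∈ Finset.range a, 1 / ((j : ℝ) + 1) + ∑ j ∈ Finset.range b, 1 / ((j : ℝ) + 1) -
          ∑ j ∈ Finset.range (b + a), 1 / ((j : ℝ) + 1) := by
      intro a b
      rw [Finset.sum_range_add _ b a, Finset.sum_sub_distrib]
      have : ∀ j : ℕ, 1 / (((b + j : ℕ) : ℝ) + 1) = 1 / ((j : ℝ) + 1 + b) := fun j ↦ by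
        push_cast; ring_nf
      simp only [this]
      ring
    rw [key, key, add_comm N n]
    ring
  rw [h, harmonic]
  push_cast
  refine Finset.sum_le_sum fun j _ ↦ ?_
  rw [one_div]
  have : 0 ≤ 1 / ((j : ℝ) + 1 + n) := by positivity
  linarith

/-- Polynomial growth of the product on the left half-plane: the `j`-th factor is
`1 + O(min (1 / j, |t| / j²))`, and these errors sum to `O(1 + log (1 + |t|))`. -/
lemma exists_norm_tprod_ratio_le {γ α : ℝ} (hγ : 0 < γ) (hα0 : 0 ≤ α) (hα1 : α < 1) :
    ∃ (C : ℝ) (m : ℕ), ∀ t : ℂ, t.re ≤ 0 → ‖∏' j, ratio γ α t j‖ ≤ C * (1 + ‖t‖) ^ m := by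
  set K := slope γ α / γ with hK
  have hK0 : 0 ≤ K := div_nonneg (slope_nonneg hγ hα0 hα1) hγ.le
  set m := ⌈4 * K⌉₊ with hm
  refine ⟨Real.exp m, m, fun t ht ↦ ?_⟩
  set N := ⌈‖t‖⌉₊ with hN
  have htN : ‖t‖ ≤ N := Nat.le_ceil _
  have hterm : ∀ j : ℕ, ‖ratio γ α t j - 1‖ ≤
      4 * K * (1 / ((j : ℝ) + 1) - 1 / ((j : ℝ) + 1 + N)) := by
    intro j
    have h1 := norm_ratio_sub_one_le_sq hγ hα0 hα1 (t := t) (j := j) (r := j + 1) (by positivity)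
      (by linarith)
    have h2 : ‖ratio γ α t j - 1‖ ≤ 2 * K / (j + 1) := by
      refine (norm_ratio_sub_one_le hγ hα0 hα1 t j).trans ?_
      rw [F_eq_hyp, F_eq_hyp]
      have e1 := norm_hyp_sub_const_le hγ hα0 hα1 (r := (j + 1) * γ) (by positivity)
        (w := (j + 1 - t) * γ) (by simp; gcongr; linarith)
      have e2 := norm_hyp_sub_const_le hγ hα0 hα1 (r := (j + 1) * γ) (by positivity)
        (w := (j + 1) * γ) (by simp)
      have e3 : 2 * K / (j + 1) = slope γ α / ((j + 1) * γ) + slope γ α / ((j + 1) * γ) := by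
        rw [hK]; field_simp; ring
      rw [e3]
      refine le_trans ?_ (add_le_add e1 e2)
      rw [← norm_sub_rev (((1 - α) ^ (-γ) : ℝ) : ℂ) (hyp γ α ((j + 1) * γ))]
      refine le_trans (le_of_eq ?_) (norm_add_le _ _)
      congr 1; ring
    have hj : (0 : ℝ) < j + 1 := by positivity
    have hN0 : (0 : ℝ) ≤ N := N.cast_nonneg
    have e : 4 * K * (1 / ((j : ℝ) + 1) - 1 / ((j : ℝ) + 1 + N)) =
        4 * K * N / ((j + 1) * (j + 1 + N)) := by field_simp; ring
    rw [e]
    rcases le_total (N : ℝ) (j + 1) with hc | hc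
    · refine h1.trans ?_
      rw [div_le_div_iff₀ (by positivity) (by positivity)]
      have : K * ‖t‖ * ((j + 1) * (j + 1 + N)) ≤ K * N * ((j + 1) * (2 * (j + 1))) := by
        gcongr; linarith
      have h0 : 0 ≤ K * N * ((j + 1) * (2 * (j + 1))) := by positivity
      nlinarith
    · refine h2.trans ?_
      rw [div_le_div_iff₀ (by positivity) (by positivity)]
      have : 2 * K * ((j + 1) * (j + 1 + N)) ≤ 2 * K * ((j + 1) * (N + N)) := by gcongr
      nlinarith
  have hlogN : (harmonic N : ℝ) ≤ 1 + Real.log (1 + ‖t‖) := by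
    refine (harmonic_le_one_add_log N).trans ?_
    have : Real.log N ≤ Real.log (1 + ‖t‖) := by
      rcases Nat.eq_zero_or_pos N with h | h
      · rw [h, Nat.cast_zero, Real.log_zero]
        exact Real.log_nonneg (by linarith [norm_nonneg t])
      · refine Real.log_le_log (by exact_mod_cast h) ?_
        rw [add_comm]; exact (Nat.ceil_lt_add_one (norm_nonneg t)).le
    linarith
  have hprod : ∀ n, ‖∏ j ∈ Finset.range n, ratio γ α t j‖ ≤
      Real.exp m * (1 + ‖t‖) ^ m := by
    intro n
    have hpos : 0 < 1 + ‖t‖ := by linarith [norm_nonneg t]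
    calc ‖∏ j ∈ Finset.range n, ratio γ α t j‖
        ≤ ∏ j ∈ Finset.range n, Real.exp ‖ratio γ α t j - 1‖ := by
          rw [norm_prod]
          refine Finset.prod_le_prod (fun _ _ ↦ norm_nonneg _) fun j _ ↦ ?_
          have : ‖ratio γ α t j‖ ≤ ‖ratio γ α t j - 1‖ + 1 := by
            simpa using norm_add_le (ratio γ α t j - 1) 1
          exact this.trans (Real.add_one_le_exp _)
      _ = Real.exp (∑ j ∈ Finset.range n, ‖ratio γ α t j - 1‖) := (Real.exp_sum _ _).symm
      _ ≤ Real.exp (m * (1 + Real.log (1 + ‖t‖))) := by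
          refine Real.exp_le_exp.2 ?_
          refine (Finset.sum_le_sum fun j _ ↦ hterm j).trans ?_
          rw [← Finset.mul_sum]
          have h1 : 0 ≤ 1 + Real.log (1 + ‖t‖) := by
            have := Real.log_nonneg (show 1 ≤ 1 + ‖t‖ by linarith [norm_nonneg t])
            linarith
          exact (mul_le_mul_of_nonneg_left
            ((sum_one_div_sub_one_div_le_harmonic n N).trans hlogN) (by positivity)).trans
            (mul_le_mul_of_nonneg_right (Nat.le_ceil _) h1)
      _ = Real.exp m * (1 + ‖t‖) ^ m := by
          rw [mul_add, mul_one, Real.exp_add, Real.exp_nat_mul, Real.exp_log hpos]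
  exact le_of_tendsto (multipliable_ratio hγ hα0 hα1 t).hasProd.tendsto_prod_nat.norm
    (Eventually.of_forall hprod)

/-- Polynomial growth of `growthFactor` on closed vertical strips to the left of
`Re t = 1 + 1 / γ`. -/
lemma exists_norm_growthFactor_le {γ α : ℝ} (hγ : 0 < γ) (hα0 : 0 ≤ α) (hα1 : α < 1) {b : ℝ}
    (hb : b < 1 + 1 / γ) (a : ℝ) : ∃ (C : ℝ) (m : ℕ), 0 ≤ C ∧ ∀ t : ℂ, a ≤ t.re → t.re ≤ b →
      ‖growthFactor γ α t‖ ≤ C * (1 + ‖t‖) ^ m := by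
  have hp : (0 : ℝ) < 1 - α := by linarith
  have hk : ∀ (k : ℕ) (a b : ℝ), b < 1 + 1 / γ → b ≤ k → ∃ (C : ℝ) (m : ℕ), 0 ≤ C ∧ ∀ t : ℂ,
      a ≤ t.re → t.re ≤ b → ‖growthFactor γ α t‖ ≤ C * (1 + ‖t‖) ^ m := by
    intro k
    induction k with
    | zero =>
      intro a b _ hb0
      obtain ⟨C, m, hC⟩ := exists_norm_tprod_ratio_le hγ hα0 hα1
      have hC0 : 0 ≤ C := by simpa using (norm_nonneg _).trans (hC 0 (by simp))
      refine ⟨(1 - α) ^ (-(γ * 0)) * C, m, by positivity, fun t _ htb ↦ ?_⟩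
      have ht0 : t.re ≤ 0 := htb.trans (by simpa using hb0)
      rw [growthFactor, norm_mul, norm_cpow_eq_rpow_re_of_pos hp, mul_assoc]
      refine mul_le_mul ?_ (hC t ht0) (norm_nonneg _) (by positivity)
      refine Real.rpow_le_rpow_of_exponent_ge hp (by linarith) ?_
      simp only [neg_re, mul_re, ofReal_re, ofReal_im, zero_mul, sub_zero]
      nlinarith
    | succ k ih =>
      intro a b hbγ hbk
      push_cast at hbk
      obtain ⟨C, m, hC0, hC⟩ := ih (a - 1) (b - 1) (by linarith) (by linarith)
      have h1 : 0 < 1 + (1 - b) * γ := by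
        have := mul_lt_mul_of_pos_right hbγ hγ
        field_simp at this
        linarith
      set δ := min 1 (1 + (1 - b) * γ) with hδ
      have hδ0 : 0 < δ := lt_min one_pos h1
      refine ⟨C * 2 ^ m * ((1 - α) ^ (-γ) * (1 + 1 / δ)), m, by positivity, fun t hta htb ↦ ?_⟩
      have hF : ‖F γ α (1 - t)‖ ≤ (1 - α) ^ (-γ) * (1 + 1 / δ) := by
        rw [F_eq_hyp]
        refine norm_hyp_le hγ hα0 hα1 hδ0 (min_le_left _ _) ?_
        have h2 : δ ≤ 1 + (1 - b) * γ := min_le_right _ _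
        have h3 : (1 - b) * γ ≤ (1 - t.re) * γ := by gcongr
        simp
        linarith
      have hA := hC (t - 1) (by simp; linarith) (by simp; linarith)
      have h4 : ‖t - 1‖ ≤ ‖t‖ + 1 := by simpa using norm_sub_le t 1
      rw [growthFactor_eq hγ hα0 hα1, norm_mul]
      calc _ ≤ C * (1 + ‖t - 1‖) ^ m * ((1 - α) ^ (-γ) * (1 + 1 / δ)) := by gcongr
        _ ≤ C * (2 * (1 + ‖t‖)) ^ m * ((1 - α) ^ (-γ) * (1 + 1 / δ)) := by
          gcongr; linarith [norm_nonneg t]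
        _ = _ := by rw [mul_pow]; ring
  obtain ⟨k, hkb⟩ := exists_nat_ge b
  exact hk k a b hb hkb

/-! ### Integrals along vertical lines -/

lemma integrable_of_norm_le_div_sq {f : ℝ → ℂ} (hf : Continuous f) {C : ℝ}
    (hC : ∀ y : ℝ, 1 ≤ |y| → ‖f y‖ ≤ C / y ^ 2) : Integrable f := by
  have hC0 : 0 ≤ C := by
    have := (norm_nonneg _).trans (hC 1 (by simp)); simpa using this
  obtain ⟨B, hB⟩ := (isCompact_Icc (a := (-1 : ℝ)) (b := 1)).exists_bound_of_continuousOn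
    hf.continuousOn
  have hB0 : 0 ≤ B := (norm_nonneg _).trans (hB 0 (by simp))
  refine ((integrable_inv_one_add_sq).const_mul (2 * B + 2 * C)).mono'
    hf.aestronglyMeasurable (Eventually.of_forall fun y ↦ ?_)
  rw [← div_eq_mul_inv, le_div_iff₀ (by positivity)]
  rcases le_total 1 |y| with h | h
  · have hy : 1 ≤ y ^ 2 := by rw [← sq_abs]; exact one_le_pow₀ h
    have h1 := hC y h
    rw [le_div_iff₀ (by positivity)] at h1
    nlinarith [norm_nonneg (f y)]
  · have hy : y ^ 2 ≤ 1 := by rw [← sq_abs]; exact pow_le_one₀ (abs_nonneg y) h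
    have h1 := hB y (abs_le.1 h)
    nlinarith [norm_nonneg (f y)]

lemma continuous_comp_line {f : ℂ → ℂ} {s : Set ℂ} (hf : ContinuousOn f s) {c : ℝ}
    (hc : ∀ t : ℂ, t.re = c → t ∈ s) : Continuous fun y : ℝ ↦ f (c + y * I) :=
  hf.comp_continuous (by fun_prop) fun y ↦ hc _ (by simp)

/-- Cauchy's theorem for a vertical strip: the line of integration may be moved. -/
lemma integral_line_eq_of_differentiableOn_strip {f : ℂ → ℂ} {a b : ℝ} (hab : a ≤ b)
    (hf : DifferentiableOn ℂ f {t | a ≤ t.re ∧ t.re ≤ b}) {C : ℝ}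
    (hC : ∀ t : ℂ, a ≤ t.re → t.re ≤ b → 1 ≤ |t.im| → ‖f t‖ ≤ C / t.im ^ 2) :
    ∫ y : ℝ, f (a + y * I) = ∫ y : ℝ, f (b + y * I) := by
  have hint : ∀ c : ℝ, a ≤ c → c ≤ b → Integrable fun y : ℝ ↦ f (c + y * I) := by
    intro c hac hcb
    refine integrable_of_norm_le_div_sq (continuous_comp_line hf.continuousOn
      (fun t ht ↦ ⟨by rwa [ht], by rwa [ht]⟩)) (C := C) fun y hy ↦ ?_
    simpa using hC (c + y * I) (by simpa) (by simpa) (by simpa using hy)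
  have hlim : ∀ c : ℝ, a ≤ c → c ≤ b → Tendsto (fun R : ℝ ↦ ∫ y in (-R)..R, f (c + y * I)) atTop
      (𝓝 (∫ y : ℝ, f (c + y * I))) := fun c h1 h2 ↦
    intervalIntegral_tendsto_integral (hint c h1 h2) tendsto_neg_atTop_atBot tendsto_id
  have hrect : ∀ R : ℝ, (∫ x : ℝ in a..b, f (x + (-R : ℝ) * I)) - (∫ x : ℝ in a..b, f (x + R * I)) +
      I • (∫ y : ℝ in (-R)..R, f (b + y * I)) - I • (∫ y : ℝ in (-R)..R, f (a + y * I)) = 0 := by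
    intro R
    have := integral_boundary_rect_eq_zero_of_differentiableOn f (a + (-R : ℝ) * I) (b + R * I)
      (hf.mono fun t ht ↦ by
        have := ht.1
        simp [Set.uIcc_of_le hab] at this
        exact this)
    simpa using this
  have hhor : ∀ ε : ℝ, |ε| = 1 →
      Tendsto (fun R : ℝ ↦ ∫ x : ℝ in a..b, f (x + (ε * R : ℝ) * I)) atTop (𝓝 0) := by
    intro ε hε
    have h0 : Tendsto (fun R : ℝ ↦ C / R ^ 2 * |b - a|) atTop (𝓝 0) := by
      have : Tendsto (fun R : ℝ ↦ C / R ^ 2) atTop (𝓝 0) :=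
        tendsto_const_nhds.div_atTop (tendsto_pow_atTop two_ne_zero)
      simpa using this.mul_const |b - a|
    refine squeeze_zero_norm' ?_ h0
    filter_upwards [eventually_ge_atTop 1] with R hR
    refine intervalIntegral.norm_integral_le_of_norm_le_const fun x hx ↦ ?_
    rw [Set.uIoc_of_le hab] at hx
    have hsq : ε ^ 2 = 1 := by rw [← sq_abs, hε, one_pow]
    have := hC (x + (ε * R : ℝ) * I) (by simpa using hx.1.le) (by simpa using hx.2)
      (by simp [abs_mul, hε]; exact hR.trans (le_abs_self R))
    simpa [mul_pow, hsq] using this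
  have h1 := hhor (-1) (by simp)
  have h2 := hhor 1 (by simp)
  simp only [neg_one_mul, one_mul] at h1 h2
  have h3 := ((h1.sub h2).add ((hlim b hab le_rfl).const_smul I)).sub
    ((hlim a le_rfl hab).const_smul I)
  have h4 := tendsto_nhds_unique (h3.congr hrect) tendsto_const_nhds
  rw [sub_zero, zero_add, ← smul_sub, smul_eq_mul, mul_eq_zero, sub_eq_zero] at h4
  exact (h4.resolve_left I_ne_zero).symm

lemma integral_inv_sq_add_sq {a : ℝ} (ha : 0 < a) :
    Integrable (fun y : ℝ ↦ (a ^ 2 + y ^ 2)⁻¹) ∧ ∫ y : ℝ, (a ^ 2 + y ^ 2)⁻¹ = Real.pi / a := by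
  have h : ∀ y : ℝ, (a ^ 2 + y ^ 2)⁻¹ = (a ^ 2)⁻¹ * (1 + (y / a) ^ 2)⁻¹ := by
    intro y; field_simp
  simp only [h]
  refine ⟨(integrable_inv_one_add_sq.comp_div ha.ne').const_mul _, ?_⟩
  rw [integral_const_mul, Measure.integral_comp_div (fun y ↦ (1 + y ^ 2)⁻¹) a,
    integral_univ_inv_one_add_sq, abs_of_pos ha, smul_eq_mul]
  field_simp

/-- The model residue computation: the function `1 / (t (t + 1))` has residue `1` at `0`. -/
lemma integral_line_inv_mul_sub :
    (∫ y : ℝ, 1 / (((1 / 2 : ℝ) + y * I) * ((1 / 2 : ℝ) + y * I + 1) : ℂ)) -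
      ∫ y : ℝ, 1 / (((-1 / 2 : ℝ) + y * I) * ((-1 / 2 : ℝ) + y * I + 1) : ℂ) = 2 * Real.pi := by
  have hne : ∀ (c y : ℝ), c ≠ 0 → (c : ℂ) + y * I ≠ 0 := by
    intro c y hc h
    have := congrArg re h
    simp at this
    exact hc this
  have hint : ∀ c : ℝ, c ≠ 0 → c + 1 ≠ 0 →
      Integrable fun y : ℝ ↦ 1 / ((c + y * I) * (c + y * I + 1) : ℂ) := by
    intro c hc hc1
    have h1 : ∀ y : ℝ, (c : ℂ) + y * I + 1 ≠ 0 := by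
      intro y
      have := hne (c + 1) y hc1
      push_cast at this
      convert this using 1; ring
    refine integrable_of_norm_le_div_sq (C := 1) ?_ fun y hy ↦ ?_
    · exact Continuous.div continuous_const (by fun_prop)
        fun y ↦ mul_ne_zero (hne c y hc) (h1 y)
    · rw [norm_div, norm_one, norm_mul, ← sq_abs, sq]
      have e1 : |y| ≤ ‖(c : ℂ) + y * I‖ := by simpa using abs_im_le_norm ((c : ℂ) + y * I)
      have e2 : |y| ≤ ‖(c : ℂ) + y * I + 1‖ := by simpa using abs_im_le_norm ((c : ℂ) + y * I + 1)
      gcongr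
  have hi1 := hint (1 / 2) (by norm_num) (by norm_num)
  have hi2 := hint (-1 / 2) (by norm_num) (by norm_num)
  rw [← integral_sub hi1 hi2]
  set k : ℝ → ℂ := fun y ↦ 1 / (((1 / 2 : ℝ) + y * I) * ((1 / 2 : ℝ) + y * I + 1) : ℂ) -
    1 / (((-1 / 2 : ℝ) + y * I) * ((-1 / 2 : ℝ) + y * I + 1) : ℂ) with hk
  have hki : Integrable k := hi1.sub hi2
  -- only the even part contributes, and it is a combination of two Cauchy densities
  have hodd : ∀ y : ℝ, k y + k (-y) =
      ((3 * (((1 / 2 : ℝ) ^ 2 + y ^ 2)⁻¹ - ((3 / 2 : ℝ) ^ 2 + y ^ 2)⁻¹) : ℝ) : ℂ) := by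
    intro y
    have e1 := hne (1 / 2) y (by norm_num)
    have e2 := hne (3 / 2) y (by norm_num)
    have e3 := hne (-1 / 2) y (by norm_num)
    have e4 := hne (1 / 2) (-y) (by norm_num)
    have e5 := hne (3 / 2) (-y) (by norm_num)
    have e6 := hne (-1 / 2) (-y) (by norm_num)
    have f1 : ((1 / 2 : ℝ) ^ 2 + y ^ 2 : ℂ) =
        ((1 / 2 : ℝ) + y * I) * ((1 / 2 : ℝ) + (-y : ℝ) * I) := by
      push_cast; ring_nf; simp
    have f2 : ((3 / 2 : ℝ) ^ 2 + y ^ 2 : ℂ) =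
        ((3 / 2 : ℝ) + y * I) * ((3 / 2 : ℝ) + (-y : ℝ) * I) := by
      push_cast; ring_nf; simp
    have f3 : ((-1 / 2 : ℝ) + y * I : ℂ) = -((1 / 2 : ℝ) + (-y : ℝ) * I) := by push_cast; ring
    have f4 : ((-1 / 2 : ℝ) + (-y : ℝ) * I : ℂ) = -((1 / 2 : ℝ) + y * I) := by push_cast; ring
    have g1 : ((1 / 2 : ℝ) + y * I + 1 : ℂ) = (3 / 2 : ℝ) + y * I := by push_cast; ring
    have g2 : ((1 / 2 : ℝ) + (-y : ℝ) * I + 1 : ℂ) = (3 / 2 : ℝ) + (-y : ℝ) * I := by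
      push_cast; ring
    have g3 : ((-1 / 2 : ℝ) + y * I + 1 : ℂ) = (1 / 2 : ℝ) + y * I := by push_cast; ring
    have g4 : ((-1 / 2 : ℝ) + (-y : ℝ) * I + 1 : ℂ) = (1 / 2 : ℝ) + (-y : ℝ) * I := by
      push_cast; ring
    simp only [hk]
    rw [g1, g2, g3, g4, f3, f4]
    simp only [ofReal_mul, ofReal_sub, ofReal_inv, ofReal_add, ofReal_pow]
    rw [f1, f2]
    have s1 : ((3 / 2 : ℝ) + y * I : ℂ) = ((1 / 2 : ℝ) + y * I) + 1 := g1.symm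
    have s2 : ((3 / 2 : ℝ) + (-y : ℝ) * I : ℂ) = ((1 / 2 : ℝ) + (-y : ℝ) * I) + 1 := g2.symm
    have s3 : ((1 / 2 : ℝ) + (-y : ℝ) * I : ℂ) = 1 - ((1 / 2 : ℝ) + y * I) := by
      push_cast; ring
    rw [s1] at e2 ⊢
    rw [s2] at e5 ⊢
    rw [s3] at e4 e5 ⊢
    generalize ((1 / 2 : ℝ) + y * I : ℂ) = u at *
    push_cast
    field_simp
    ring
  have h2 : 2 * ∫ y, k y = 4 * Real.pi := by
    have hneg : ∫ y, k (-y) = ∫ y, k y := integral_neg_eq_self k volume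
    obtain ⟨i1, v1⟩ := integral_inv_sq_add_sq (a := 1 / 2) (by norm_num)
    obtain ⟨i2, v2⟩ := integral_inv_sq_add_sq (a := 3 / 2) (by norm_num)
    calc 2 * ∫ y, k y = ∫ y, (k y + k (-y)) := by
          rw [integral_add hki hki.comp_neg, hneg]; ring
      _ = _ := by
          simp only [hodd]
          rw [integral_complex_ofReal, integral_const_mul, integral_sub i1 i2, v1, v2]
          push_cast
          ring
  linear_combination h2 / 2

/-- Moving the line of integration of `φ(t) / t` across its simple pole at `0`. -/
lemma integral_line_div_self_sub {φ : ℂ → ℂ}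
    (hφ : DifferentiableOn ℂ φ {t | (-1 / 2 : ℝ) ≤ t.re ∧ t.re ≤ (1 / 2 : ℝ)}) {C : ℝ}
    (hC : ∀ t : ℂ, (-1 / 2 : ℝ) ≤ t.re → t.re ≤ (1 / 2 : ℝ) → 1 ≤ |t.im| →
      ‖φ t‖ ≤ C / t.im ^ 2) :
    (∫ y : ℝ, φ ((1 / 2 : ℝ) + y * I) / ((1 / 2 : ℝ) + y * I)) -
      ∫ y : ℝ, φ ((-1 / 2 : ℝ) + y * I) / ((-1 / 2 : ℝ) + y * I) = 2 * Real.pi * φ 0 := by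
  set S : Set ℂ := {t | (-1 / 2 : ℝ) ≤ t.re ∧ t.re ≤ (1 / 2 : ℝ)} with hS
  have hS0 : S ∈ 𝓝 (0 : ℂ) := by
    have : IsOpen {t : ℂ | (-1 / 2 : ℝ) < t.re ∧ t.re < (1 / 2 : ℝ)} :=
      (isOpen_lt continuous_const continuous_re).inter (isOpen_lt continuous_re continuous_const)
    exact mem_of_superset (this.mem_nhds (by constructor <;> norm_num))
      fun t ht ↦ ⟨ht.1.le, ht.2.le⟩
  have hne1 : ∀ t ∈ S, t + 1 ≠ 0 := by
    intro t ht h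
    have h1 := congrArg re h
    have h2 := ht.1
    simp at h1
    linarith
  -- subtracting a multiple of the model function makes the singularity removable
  set ψ : ℂ → ℂ := dslope (fun t ↦ φ t - φ 0 / (t + 1)) 0 with hψ
  have hψd : DifferentiableOn ℂ ψ S := by
    rw [hψ, differentiableOn_dslope hS0]
    refine hφ.sub (DifferentiableOn.div (by fun_prop) (by fun_prop) hne1)
  have hψe : ∀ t : ℂ, t ≠ 0 → t + 1 ≠ 0 → ψ t = φ t / t - φ 0 * (1 / (t * (t + 1))) := by
    intro t ht ht1
    rw [hψ, dslope_of_ne _ ht, slope_def_field]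
    simp
    field_simp
  have him : ∀ t : ℂ, 1 ≤ |t.im| → ∀ r : ℝ, 1 ≤ ‖t + r‖ ∧ |t.im| ≤ ‖t + r‖ := by
    intro t ht r
    have : |t.im| ≤ ‖t + r‖ := by simpa using abs_im_le_norm (t + r)
    exact ⟨ht.trans this, this⟩
  have hbφ : ∀ t : ℂ, (-1 / 2 : ℝ) ≤ t.re → t.re ≤ (1 / 2 : ℝ) → 1 ≤ |t.im| →
      ‖φ t / t‖ ≤ C / t.im ^ 2 := by
    intro t h1 h2 h3
    have := (him t h3 0).1
    rw [ofReal_zero, add_zero] at this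
    rw [norm_div]
    exact (div_le_self (norm_nonneg _) this).trans (hC t h1 h2 h3)
  have hbψ : ∀ t : ℂ, (-1 / 2 : ℝ) ≤ t.re → t.re ≤ (1 / 2 : ℝ) → 1 ≤ |t.im| →
      ‖ψ t‖ ≤ (C + ‖φ 0‖) / t.im ^ 2 := by
    intro t h1 h2 h3
    have e0 := him t h3 0
    have e1 := him t h3 1
    rw [ofReal_zero, add_zero] at e0
    rw [ofReal_one] at e1
    rw [hψe t (norm_pos_iff.1 (by linarith)) (norm_pos_iff.1 (by linarith)), add_div]
    refine (norm_sub_le _ _).trans (add_le_add (hbφ t h1 h2 h3) ?_)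
    rw [norm_mul, norm_div, norm_one, norm_mul, mul_one_div, ← sq_abs, sq]
    gcongr
    · exact e0.2
    · exact e1.2
  have hcauchy := integral_line_eq_of_differentiableOn_strip (by norm_num) hψd hbψ
  have hline : ∀ c : ℝ, (-1 / 2 : ℝ) ≤ c → c ≤ (1 / 2 : ℝ) → c ≠ 0 →
      ∫ y : ℝ, ψ (c + y * I) = (∫ y : ℝ, φ (c + y * I) / (c + y * I)) -
        φ 0 * ∫ y : ℝ, 1 / ((c + y * I) * (c + y * I + 1) : ℂ) := by
    intro c h1 h2 h3
    have hne : ∀ y : ℝ, (c : ℂ) + y * I ≠ 0 := fun y h ↦ by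
      have := congrArg re h; simp at this; exact h3 this
    have hmem : ∀ y : ℝ, (c : ℂ) + y * I ∈ S := fun y ↦ ⟨by simpa using h1, by simpa using h2⟩
    have hcS : ∀ t : ℂ, t.re = c → t ∈ S := fun t ht ↦ ⟨by rwa [ht], by rwa [ht]⟩
    have i1 : Integrable fun y : ℝ ↦ φ (c + y * I) / (c + y * I) :=
      integrable_of_norm_le_div_sq
        ((continuous_comp_line hφ.continuousOn hcS).div (by fun_prop) hne) (C := C) fun y hy ↦ by
          simpa using hbφ (c + y * I) (by simpa using h1) (by simpa using h2) (by simpa using hy)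
    have i2 : Integrable fun y : ℝ ↦ ψ (c + y * I) :=
      integrable_of_norm_le_div_sq (continuous_comp_line hψd.continuousOn hcS)
        (C := C + ‖φ 0‖) fun y hy ↦ by
          simpa using hbψ (c + y * I) (by simpa using h1) (by simpa using h2) (by simpa using hy)
    rw [← integral_const_mul, eq_sub_iff_add_eq]
    have i3 : Integrable fun y : ℝ ↦ φ 0 * (1 / ((c + y * I) * (c + y * I + 1) : ℂ)) :=
      (i1.sub i2).congr (Eventually.of_forall fun y ↦ by
        simp only [Pi.sub_apply, hψe _ (hne y) (hne1 _ (hmem y))]; ring)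
    rw [← integral_add i2 i3]
    refine integral_congr_ae (Eventually.of_forall fun y ↦ ?_)
    simp only [hψe _ (hne y) (hne1 _ (hmem y))]
    ring
  rw [hline _ le_rfl (by norm_num) (by norm_num), hline _ (by norm_num) le_rfl (by norm_num)]
    at hcauchy
  linear_combination -hcauchy + φ 0 * integral_line_inv_mul_sub

/-- The Gamma function decays faster than any power along vertical strips. -/
lemma exists_norm_Gamma_le_div_pow (a b : ℝ) (N : ℕ) : ∃ C : ℝ, 0 ≤ C ∧ ∀ t : ℂ, a ≤ t.re →
    t.re ≤ b → 1 ≤ |t.im| → ‖Gamma t‖ ≤ C / |t.im| ^ N := by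
  have hre : ∀ z : ℂ, 0 < z.re → ‖Gamma z‖ ≤ Real.Gamma z.re := by
    intro z hz
    rw [Gamma_eq_integral hz, Real.Gamma_eq_integral hz, GammaIntegral]
    refine (norm_integral_le_integral_norm _).trans (le_of_eq ?_)
    refine setIntegral_congr_fun measurableSet_Ioi fun x hx ↦ ?_
    rw [norm_mul, norm_real, Real.norm_of_nonneg (Real.exp_pos _).le,
      norm_cpow_eq_rpow_re_of_pos hx]
    simp
  -- every step to the right gains a factor of modulus at least `|Im t|`
  have hshift : ∀ (t : ℂ) (M : ℕ), t.im ≠ 0 → ‖Gamma t‖ * |t.im| ^ M ≤ ‖Gamma (t + M)‖ := by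
    intro t M ht
    induction M with
    | zero => simp
    | succ M ih =>
      have hne : t + M ≠ 0 := fun h ↦ ht (by simpa using congrArg im h)
      have him : |t.im| ≤ ‖t + M‖ := by simpa using abs_im_le_norm (t + M)
      rw [pow_succ, ← mul_assoc, Nat.cast_succ, ← add_assoc, Gamma_add_one _ hne, norm_mul,
        mul_comm ‖t + M‖]
      gcongr
  obtain ⟨M, hM⟩ := exists_nat_ge (1 - a)
  obtain ⟨B, hB⟩ :=
    (isCompact_Icc (a := (1 : ℝ)) (b := b + (N + M : ℕ))).exists_bound_of_continuousOn
    (f := Real.Gamma) (fun x hx ↦ (Real.differentiableAt_Gamma fun m ↦ by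
      have := hx.1; have := Nat.cast_nonneg (α := ℝ) m; linarith).continuousAt.continuousWithinAt)
  refine ⟨max B 0, le_max_right _ _, fun t h1 h2 h3 ↦ ?_⟩
  have hpos : 0 < |t.im| := by linarith
  rw [le_div_iff₀ (by positivity)]
  calc ‖Gamma t‖ * |t.im| ^ N ≤ ‖Gamma t‖ * |t.im| ^ (N + M) := by
        gcongr
        omega
    _ ≤ ‖Gamma (t + (N + M : ℕ))‖ := hshift t _ (abs_pos.1 hpos)
    _ ≤ Real.Gamma (t.re + (N + M : ℕ)) := by
        refine (hre _ ?_).trans (le_of_eq (by simp))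
        simp; linarith [Nat.cast_nonneg (α := ℝ) N]
    _ ≤ B := by
        refine (le_abs_self _).trans (hB _ ⟨?_, by linarith⟩)
        push_cast; linarith [Nat.cast_nonneg (α := ℝ) N]
    _ ≤ max B 0 := le_max_left _ _

/-- A Gamma factor makes `growthFactor` decay like `(Im t)⁻²` on vertical strips. The argument `u`
of `Γ` is `t`, `t + 1` or `1 - t` in the applications. -/
lemma exists_norm_Gamma_mul_growthFactor_le {γ α : ℝ} (hγ : 0 < γ) (hα0 : 0 ≤ α) (hα1 : α < 1)
    (a' b' a : ℝ) {b : ℝ} (hb : b < 1 + 1 / γ) : ∃ C : ℝ, 0 ≤ C ∧ ∀ t u : ℂ, a ≤ t.re → t.re ≤ b →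
      a' ≤ u.re → u.re ≤ b' → |u.im| = |t.im| → 1 ≤ |t.im| →
        ‖Gamma u * growthFactor γ α t‖ ≤ C / t.im ^ 2 := by
  obtain ⟨C, m, hC0, hC⟩ := exists_norm_growthFactor_le hγ hα0 hα1 hb a
  obtain ⟨D, hD0, hD⟩ := exists_norm_Gamma_le_div_pow a' b' (m + 2)
  refine ⟨D * (C * (2 + |a| + |b|) ^ m), by positivity, fun t u h1 h2 h1' h2' him h3 ↦ ?_⟩
  have hpos : 0 < |t.im| := by linarith
  have hnorm : 1 + ‖t‖ ≤ (2 + |a| + |b|) * |t.im| := by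
    have e1 := norm_le_abs_re_add_abs_im t
    have e2 : |t.re| ≤ |a| + |b| := by
      rw [abs_le]
      constructor <;> linarith [neg_abs_le a, le_abs_self b, abs_nonneg a, abs_nonneg b]
    nlinarith [abs_nonneg a, abs_nonneg b]
  have hG : ‖Gamma u‖ ≤ D / |t.im| ^ (m + 2) := by
    rw [← him] at h3 ⊢
    exact hD u h1' h2' h3
  rw [norm_mul]
  calc _ ≤ D / |t.im| ^ (m + 2) * (C * ((2 + |a| + |b|) * |t.im|) ^ m) := by
        refine mul_le_mul hG ((hC t h1 h2).trans ?_) (norm_nonneg _) (by positivity)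
        gcongr
    _ = _ := by
        rw [← sq_abs t.im, mul_pow, pow_add]
        field_simp

/-! ### The generating function -/

lemma summable_gTerm {γ α : ℝ} (hγ : 0 < γ) (hα0 : 0 ≤ α) (hα1 : α < 1) (x : ℂ) :
    Summable (gTerm γ α x) := by
  refine Summable.of_norm_bounded (Real.summable_pow_div_factorial ‖x‖) fun l ↦ ?_
  have h1 : 1 ≤ ∏ j ∈ Finset.range (l + 1), ‖F γ α (j : ℂ)‖ :=
    Finset.one_le_prod fun j _ ↦ norm_F_natCast_ge hγ hα0 hα1 j
  rw [gTerm, norm_div, norm_mul, norm_pow, norm_neg, norm_natCast, norm_prod]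
  gcongr
  exact le_mul_of_one_le_right (by positivity) h1

/-- The denominator `∏_{i=1}^{k} (t - i) F_{i - t}` by which the functional equations of `Γ` and of
`growthFactor` relate the values at `t - k` and at `t`. -/
def shiftDenom (γ α : ℝ) (k : ℕ) (t : ℂ) : ℂ :=
  ∏ j ∈ Finset.range k, ((t - ((j : ℂ) + 1)) * F γ α ((j : ℂ) + 1 - t))

lemma shiftDenom_factor_ne_zero {γ α : ℝ} (hγ : 0 < γ) (hα0 : 0 ≤ α) (hα1 : α < 1) {t : ℂ}
    (ht : t.re < 1) (j : ℕ) : (t - ((j : ℂ) + 1)) * F γ α ((j : ℂ) + 1 - t) ≠ 0 := by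
  have hj : (0 : ℝ) ≤ j := j.cast_nonneg
  refine mul_ne_zero (fun h ↦ ?_) (F_ne_zero hγ hα0 hα1 (by simp; linarith))
  have := congrArg re h
  simp at this
  linarith

lemma shiftDenom_ne_zero {γ α : ℝ} (hγ : 0 < γ) (hα0 : 0 ≤ α) (hα1 : α < 1) {t : ℂ}
    (ht : t.re < 1) (k : ℕ) : shiftDenom γ α k t ≠ 0 :=
  Finset.prod_ne_zero_iff.2 fun j _ ↦ shiftDenom_factor_ne_zero hγ hα0 hα1 ht j

lemma differentiableOn_shiftDenom {γ α : ℝ} (hγ : 0 < γ) (hα0 : 0 ≤ α) (hα1 : α < 1) (k : ℕ) :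
    DifferentiableOn ℂ (shiftDenom γ α k) {t | t.re < 1} := by
  unfold shiftDenom
  refine DifferentiableOn.fun_finsetProd fun j _ ↦ DifferentiableOn.mul (by fun_prop) ?_
  refine (differentiableOn_F hγ hα0 hα1).comp (f := fun t : ℂ ↦ (j : ℂ) + 1 - t)
    (by fun_prop) fun t ht ↦ ?_
  have h2 : 0 < γ⁻¹ := by positivity
  have hj : (0 : ℝ) ≤ j := j.cast_nonneg
  simp at ht ⊢
  linarith

lemma shiftDenom_succ_add_one (γ α : ℝ) (k : ℕ) (t : ℂ) :
    shiftDenom γ α (k + 1) (t + 1) = shiftDenom γ α k t * (t * F γ α (-t)) := by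
  rw [shiftDenom, Finset.prod_range_succ', shiftDenom]
  congr 1
  · refine Finset.prod_congr rfl fun j _ ↦ ?_
    rw [Nat.cast_succ, add_sub_add_right_eq_sub, add_sub_add_right_eq_sub]
  · rw [Nat.cast_zero, zero_add, add_sub_cancel_right, sub_add_cancel_right]

/-- The residue of `shiftedIntegrand` at `0` is a term of the generating function. -/
lemma pow_div_shiftDenom_zero {γ α : ℝ} (hγ : 0 < γ) (hα0 : 0 ≤ α) (hα1 : α < 1) (x : ℂ) (k : ℕ) :
    x ^ k / shiftDenom γ α k 0 = gTerm γ α x k := by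
  have h : shiftDenom γ α k 0 = (-1) ^ k * ((k.factorial : ℂ) *
      ∏ j ∈ Finset.range (k + 1), F γ α (j : ℂ)) := by
    induction k with
    | zero => simp [shiftDenom, F_zero hγ hα0 hα1]
    | succ k ih =>
      rw [shiftDenom, Finset.prod_range_succ, ← shiftDenom, ih, Finset.prod_range_succ _ (k + 1),
        Nat.factorial_succ]
      push_cast
      rw [sub_zero]
      ring
  rw [h, gTerm, neg_pow x, mul_comm ((-1) ^ k) (x ^ k), ← div_div,
    div_eq_mul_inv (x ^ k) ((-1) ^ k), ← inv_pow, inv_neg, inv_one]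

lemma one_le_norm_shiftDenom {γ α : ℝ} (hγ : 0 < γ) (hα0 : 0 ≤ α) (hα1 : α < 1) (k : ℕ) {t : ℂ}
    (ht : t.re < 1) (hi : 1 ≤ |t.im|) : 1 ≤ ‖shiftDenom γ α k t‖ := by
  rw [shiftDenom, norm_prod]
  refine Finset.one_le_prod fun j _ ↦ ?_
  have hj : (0 : ℝ) ≤ j := j.cast_nonneg
  rw [norm_mul]
  refine one_le_mul_of_one_le_of_one_le ?_ ?_
  · refine hi.trans ?_
    simpa using abs_im_le_norm (t - ((j : ℂ) + 1))
  · rw [F_eq_hyp]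
    refine one_le_norm_hyp hγ hα0 hα1 ?_
    simp
    exact mul_nonneg (by linarith) hγ.le

lemma factorial_le_norm_shiftDenom {γ α : ℝ} (hγ : 0 < γ) (hα0 : 0 ≤ α) (hα1 : α < 1) (k : ℕ)
    {t : ℂ} (ht : t.re ≤ 0) : (k.factorial : ℝ) ≤ ‖shiftDenom γ α k t‖ := by
  rw [shiftDenom, norm_prod, ← Finset.prod_range_add_one_eq_factorial]
  push_cast
  refine Finset.prod_le_prod (fun j _ ↦ by positivity) fun j _ ↦ ?_
  have hj : (0 : ℝ) ≤ j := j.cast_nonneg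
  rw [norm_mul]
  refine le_trans ?_ (le_mul_of_one_le_right (norm_nonneg _) ?_)
  · rw [norm_sub_rev]
    refine le_trans ?_ (re_le_norm _)
    simp; linarith
  · rw [F_eq_hyp]
    refine one_le_norm_hyp hγ hα0 hα1 ?_
    simp
    exact mul_nonneg (by linarith) hγ.le

/-- The integrand of the generating function at `t - k`, rewritten through its value at `t`. -/
def shiftedIntegrand (γ α x : ℝ) (k : ℕ) (t : ℂ) : ℂ :=
  (x : ℂ) ^ (k - t) * (Gamma t * growthFactor γ α t) / shiftDenom γ α k t

lemma shiftedIntegrand_zero (γ α x : ℝ) : shiftedIntegrand γ α x 0 = gIntegrand γ α x := by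
  ext t
  simp [shiftedIntegrand, shiftDenom, gIntegrand, growthFactor, mul_assoc]

lemma shiftedIntegrand_succ_add_one {γ α x : ℝ} (hγ : 0 < γ) (hα0 : 0 ≤ α) (hα1 : α < 1) (k : ℕ)
    {t : ℂ} (ht0 : t ≠ 0) (ht : t.re ≤ 0) :
    shiftedIntegrand γ α x (k + 1) (t + 1) = shiftedIntegrand γ α x k t := by
  have hF : F γ α (-t) ≠ 0 := F_ne_zero hγ hα0 hα1 (by simpa using ht)
  have hD := shiftDenom_ne_zero hγ hα0 hα1 (t := t) (by linarith) k
  rw [shiftedIntegrand, shiftDenom_succ_add_one, Gamma_add_one _ ht0,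
    growthFactor_eq hγ hα0 hα1 (t + 1), add_sub_cancel_right,
    show (1 : ℂ) - (t + 1) = -t by ring, shiftedIntegrand]
  push_cast
  rw [show (k : ℂ) + 1 - (t + 1) = k - t by ring]
  field_simp

lemma norm_shiftedIntegrand {γ α x : ℝ} (hx : 0 < x) (k : ℕ) (t : ℂ) :
    ‖shiftedIntegrand γ α x k t‖ =
      x ^ (k - t.re) * ‖Gamma t * growthFactor γ α t‖ / ‖shiftDenom γ α k t‖ := by
  rw [shiftedIntegrand, norm_div, norm_mul, norm_cpow_eq_rpow_re_of_pos hx]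
  simp

/-- Powers of a fixed positive base are bounded on vertical strips. -/
lemma exists_rpow_sub_le {x : ℝ} (hx : 0 < x) (k a b : ℝ) :
    ∃ X : ℝ, 0 ≤ X ∧ ∀ u, a ≤ u → u ≤ b → x ^ (k - u) ≤ X := by
  obtain ⟨X, hX⟩ := (isCompact_Icc (a := a) (b := b)).exists_bound_of_continuousOn
    (f := fun u : ℝ ↦ x ^ (k - u))
    (Continuous.continuousOn (Continuous.rpow continuous_const (by fun_prop)
      fun _ ↦ Or.inl hx.ne'))
  refine ⟨max X 0, le_max_right _ _, fun u h1 h2 ↦ ?_⟩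
  exact (le_abs_self _).trans ((hX u ⟨h1, h2⟩).trans (le_max_left _ _))

/-- A bound for `t * shiftedIntegrand γ α x k t`, with `t Γ(t)` replaced by `Γ(t + 1)` so as to
cover `t = 0`. -/
lemma exists_norm_self_mul_shiftedIntegrand_le {γ α x : ℝ} (hγ : 0 < γ) (hα0 : 0 ≤ α) (hα1 : α < 1)
    (hx : 0 < x) (k : ℕ) (a : ℝ) {b : ℝ} (hb : b < 1) : ∃ C : ℝ, ∀ t : ℂ, a ≤ t.re →
      t.re ≤ b → 1 ≤ |t.im| → ‖(x : ℂ) ^ (k - t) * (Gamma (t + 1) * growthFactor γ α t) /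
        shiftDenom γ α k t‖ ≤ C / t.im ^ 2 := by
  have h1γ : 0 < 1 / γ := by positivity
  obtain ⟨C, hC0, hC⟩ := exists_norm_Gamma_mul_growthFactor_le hγ hα0 hα1 (a + 1) (b + 1) a
    (b := b) (by linarith)
  obtain ⟨X, hX0, hX⟩ := exists_rpow_sub_le hx k a b
  refine ⟨X * C, fun t h1 h2 h3 ↦ ?_⟩
  rw [norm_div, norm_mul, norm_cpow_eq_rpow_re_of_pos hx, mul_div_assoc X]
  refine (div_le_self (by positivity)
    (one_le_norm_shiftDenom hγ hα0 hα1 k (by linarith) h3)).trans ?_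
  have h4 := hC t (t + 1) h1 h2 (by simpa using h1) (by simpa using h2) (by simp) h3
  refine mul_le_mul ?_ h4 (norm_nonneg _) hX0
  simpa using hX _ h1 h2

lemma exists_norm_gIntegrand_le {γ α x : ℝ} (hγ : 0 < γ) (hα0 : 0 ≤ α) (hα1 : α < 1)
    (hx : 0 < x) (a : ℝ) {b : ℝ} (hb : b < 1 + 1 / γ) : ∃ C : ℝ, ∀ t : ℂ, a ≤ t.re →
      t.re ≤ b → 1 ≤ |t.im| → ‖gIntegrand γ α x t‖ ≤ C / t.im ^ 2 := by
  obtain ⟨C, hC0, hC⟩ := exists_norm_Gamma_mul_growthFactor_le hγ hα0 hα1 a b a hb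
  obtain ⟨X, hX0, hX⟩ := exists_rpow_sub_le hx (0 : ℕ) a b
  refine ⟨X * C, fun t h1 h2 h3 ↦ ?_⟩
  rw [← shiftedIntegrand_zero, norm_shiftedIntegrand hx, mul_div_assoc X]
  simp only [shiftDenom, Finset.range_zero, Finset.prod_empty, norm_one, div_one]
  exact mul_le_mul (hX _ h1 h2) (hC t t h1 h2 h1 h2 rfl h3) (norm_nonneg _) hX0

lemma differentiableOn_gIntegrand {γ α x : ℝ} (hγ : 0 < γ) (hα0 : 0 ≤ α) (hα1 : α < 1)
    (hx : 0 < x) : DifferentiableOn ℂ (gIntegrand γ α x) {t | 0 < t.re ∧ t.re < 1 + 1 / γ} := by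
  rw [← shiftedIntegrand_zero]
  unfold shiftedIntegrand
  simp only [shiftDenom, Finset.range_zero, Finset.prod_empty, div_one]
  refine DifferentiableOn.mul ?_ (DifferentiableOn.mul ?_ ?_)
  · exact DifferentiableOn.const_cpow (by fun_prop) (Or.inl (by exact_mod_cast hx.ne'))
  · intro t ht
    refine (differentiableAt_Gamma t fun m h ↦ ?_).differentiableWithinAt
    have h1 : 0 < t.re := ht.1
    rw [h] at h1
    simp at h1
    linarith [Nat.cast_nonneg (α := ℝ) m]
  · exact (differentiableOn_growthFactor hγ hα0 hα1).mono fun t ht ↦ ht.2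

lemma verticalIntegrable_gIntegrand {γ α x : ℝ} (hγ : 0 < γ) (hα0 : 0 ≤ α) (hα1 : α < 1)
    (hx : 0 < x) {c : ℝ} (hc0 : 0 < c) (hc : c < 1 + 1 / γ) :
    VerticalIntegrable (gIntegrand γ α x) c := by
  obtain ⟨C, hC⟩ := exists_norm_gIntegrand_le hγ hα0 hα1 hx c hc
  refine integrable_of_norm_le_div_sq (continuous_comp_line
    (differentiableOn_gIntegrand hγ hα0 hα1 hx).continuousOn fun t ht ↦ ⟨by rwa [ht], by rwa [ht]⟩)
    (C := C) fun y hy ↦ ?_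
  simpa using hC (c + y * I) (by simp) (by simp) (by simpa using hy)

/-- By Cauchy's theorem the integral does not depend on the line. -/
lemma integral_line_gIntegrand_eq {γ α x : ℝ} (hγ : 0 < γ) (hα0 : 0 ≤ α) (hα1 : α < 1)
    (hx : 0 < x) {a b : ℝ} (hab : a ≤ b) (ha : 0 < a) (hb : b < 1 + 1 / γ) :
    ∫ y : ℝ, gIntegrand γ α x (a + y * I) = ∫ y : ℝ, gIntegrand γ α x (b + y * I) := by
  obtain ⟨C, hC⟩ := exists_norm_gIntegrand_le hγ hα0 hα1 hx a hb
  refine integral_line_eq_of_differentiableOn_strip hab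
    ((differentiableOn_gIntegrand hγ hα0 hα1 hx).mono fun t ht ↦ ?_) hC
  exact ⟨ha.trans_le ht.1, ht.2.trans_lt hb⟩

/-- Moving the line of integration across the pole at `-k` produces the `k`-th term of the
generating function. -/
lemma integral_line_shiftedIntegrand_sub {γ α x : ℝ} (hγ : 0 < γ) (hα0 : 0 ≤ α) (hα1 : α < 1)
    (hx : 0 < x) (k : ℕ) :
    (∫ y : ℝ, shiftedIntegrand γ α x k ((1 / 2 : ℝ) + y * I)) -
      ∫ y : ℝ, shiftedIntegrand γ α x k ((-1 / 2 : ℝ) + y * I) =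
        2 * Real.pi * gTerm γ α x k := by
  have hx0 : (x : ℂ) ≠ 0 := by exact_mod_cast hx.ne'
  have h1γ : 0 < 1 / γ := by positivity
  set φ : ℂ → ℂ := fun t ↦ (x : ℂ) ^ (k - t) * (Gamma (t + 1) * growthFactor γ α t) /
    shiftDenom γ α k t with hφ
  have hφe : ∀ t : ℂ, t ≠ 0 → φ t = t * shiftedIntegrand γ α x k t := by
    intro t ht
    rw [hφ, shiftedIntegrand]
    simp only
    rw [Gamma_add_one t ht]
    ring
  have hd : DifferentiableOn ℂ φ {t | (-1 / 2 : ℝ) ≤ t.re ∧ t.re ≤ (1 / 2 : ℝ)} := by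
    refine DifferentiableOn.div (DifferentiableOn.mul ?_ (DifferentiableOn.mul ?_ ?_)) ?_ ?_
    · exact DifferentiableOn.const_cpow (by fun_prop) (Or.inl hx0)
    · intro t ht
      refine DifferentiableAt.differentiableWithinAt ?_
      refine (differentiableAt_Gamma (t + 1) fun m h ↦ ?_).comp t (f := fun t : ℂ ↦ t + 1)
        (by fun_prop)
      have h1 := ht.1
      have h2 := congrArg re h
      simp at h2
      linarith [Nat.cast_nonneg (α := ℝ) m]
    · refine (differentiableOn_growthFactor hγ hα0 hα1).mono fun t ht ↦ ?_
      have h2 := ht.2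
      simp only [Set.mem_ofPred_eq]
      linarith
    · refine (differentiableOn_shiftDenom hγ hα0 hα1 k).mono fun t ht ↦ ?_
      have h2 := ht.2
      simp only [Set.mem_ofPred_eq]
      linarith
    · exact fun t ht ↦ shiftDenom_ne_zero hγ hα0 hα1 (by linarith [ht.2]) k
  obtain ⟨C, hC⟩ := exists_norm_self_mul_shiftedIntegrand_le hγ hα0 hα1 hx k (-1 / 2)
    (b := 1 / 2) (by norm_num)
  have hres := integral_line_div_self_sub hd (C := C) hC
  have hφ0 : φ 0 = gTerm γ α x k := by
    rw [hφ]
    simp only [sub_zero, zero_add, Gamma_one, growthFactor_zero hγ hα0 hα1, mul_one,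
      cpow_natCast]
    exact pow_div_shiftDenom_zero hγ hα0 hα1 _ k
  have hline : ∀ c : ℝ, c ≠ 0 → ∀ y : ℝ,
      φ (c + y * I) / (c + y * I) = shiftedIntegrand γ α x k (c + y * I) := by
    intro c hc y
    have hne : (c : ℂ) + y * I ≠ 0 := fun h ↦ by
      have := congrArg re h; simp at this; exact hc this
    rw [hφe _ hne, mul_div_cancel_left₀ _ hne]
  rw [← hφ0, ← hres]
  simp only [hline (1 / 2) (by norm_num), hline (-1 / 2) (by norm_num)]

lemma integral_line_shiftedIntegrand_succ {γ α x : ℝ} (hγ : 0 < γ) (hα0 : 0 ≤ α) (hα1 : α < 1)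
    (k : ℕ) : ∫ y : ℝ, shiftedIntegrand γ α x (k + 1) ((1 / 2 : ℝ) + y * I) =
      ∫ y : ℝ, shiftedIntegrand γ α x k ((-1 / 2 : ℝ) + y * I) := by
  refine integral_congr_ae (Eventually.of_forall fun y ↦ ?_)
  have hre : ((-1 / 2 : ℝ) + y * I : ℂ).re = -1 / 2 := by simp
  have := shiftedIntegrand_succ_add_one (x := x) hγ hα0 hα1 k (t := (-1 / 2 : ℝ) + y * I)
    (fun h ↦ by rw [h] at hre; norm_num at hre) (by rw [hre]; norm_num)
  simp only
  rw [← this]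
  congr 1
  push_cast; ring

/-- The remainder after moving the line of integration to `Re t = -k - 1/2` tends to `0`. -/
lemma tendsto_integral_line_shiftedIntegrand {γ α x : ℝ} (hγ : 0 < γ) (hα0 : 0 ≤ α) (hα1 : α < 1)
    (hx : 0 < x) :
    Tendsto (fun k : ℕ ↦ ∫ y : ℝ, shiftedIntegrand γ α x k ((-1 / 2 : ℝ) + y * I)) atTop
      (𝓝 0) := by
  set G : ℝ → ℝ := fun y ↦ ‖Gamma ((-1 / 2 : ℝ) + y * I) *
    growthFactor γ α ((-1 / 2 : ℝ) + y * I)‖ with hG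
  have hb : ∀ k : ℕ, ‖∫ y : ℝ, shiftedIntegrand γ α x k ((-1 / 2 : ℝ) + y * I)‖ ≤
      x ^ (1 / 2 : ℝ) * (∫ y, G y) * (x ^ k / k.factorial) := by
    intro k
    have hint : Integrable G := by
      have h1γ : 0 < 1 / γ := by positivity
      obtain ⟨C, hC0, hC⟩ := exists_norm_Gamma_mul_growthFactor_le hγ hα0 hα1 (-1 / 2) (-1 / 2)
        (-1 / 2) (b := -1 / 2) (by linarith)
      refine Integrable.norm (integrable_of_norm_le_div_sq (C := C) ?_ fun y hy ↦ ?_)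
      · refine continuous_comp_line (f := fun t ↦ Gamma t * growthFactor γ α t)
          (s := {t | -1 < t.re ∧ t.re < 0}) (ContinuousOn.mul (fun t ht ↦ ?_) ?_)
          fun t ht ↦ by rw [Set.mem_ofPred_eq, ht]; norm_num
        · refine (continuousAt_Gamma t fun m h ↦ ?_).continuousWithinAt
          have h1 := ht.1
          have h2 := ht.2
          rw [h] at h1 h2
          simp at h1 h2
          omega
        · refine ((differentiableOn_growthFactor hγ hα0 hα1).mono fun t ht ↦ ?_).continuousOn
          have := ht.2
          simp only [Set.mem_ofPred_eq]
          linarith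
      · simpa using hC ((-1 / 2 : ℝ) + y * I) ((-1 / 2 : ℝ) + y * I) (by simp) (by simp) (by simp)
          (by simp) rfl (by simpa using hy)
    rw [mul_right_comm, ← integral_const_mul]
    refine norm_integral_le_of_norm_le (hint.const_mul _) (Eventually.of_forall fun y ↦ ?_)
    rw [norm_shiftedIntegrand hx]
    have hre : ((-1 / 2 : ℝ) + y * I : ℂ).re = -1 / 2 := by simp
    have hpow : x ^ ((k : ℝ) - (-1 / 2)) = x ^ (1 / 2 : ℝ) * x ^ k := by
      rw [← Real.rpow_natCast, ← Real.rpow_add hx]; congr 1; ring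
    rw [hre, hpow]
    calc _ ≤ x ^ (1 / 2 : ℝ) * x ^ k * G y / k.factorial := by
          gcongr
          exact factorial_le_norm_shiftDenom hγ hα0 hα1 k (by rw [hre]; norm_num)
      _ = _ := by ring
  refine squeeze_zero_norm hb ?_
  simpa using (FloorSemiring.tendsto_pow_div_factorial_atTop x).const_mul
    (x ^ (1 / 2 : ℝ) * ∫ y, G y)

/-- The Mellin–Barnes representation of the generating function. -/
lemma g_eq_lineIntegral {γ α x : ℝ} (hγ : 0 < γ) (hα0 : 0 ≤ α) (hα1 : α < 1)
    (hx : 0 < x) {c : ℝ} (hc0 : 0 < c) (hc : c < 1 + 1 / γ) :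
    g γ α (x : ℂ) = 1 / (2 * (Real.pi : ℂ) * I) * lineIntegral c (gIntegrand γ α x) := by
  have hpi : (Real.pi : ℂ) ≠ 0 := by exact_mod_cast Real.pi_ne_zero
  have h1γ : 0 < 1 / γ := by positivity
  set J : ℕ → ℂ := fun k ↦ ∫ y : ℝ, shiftedIntegrand γ α x k ((1 / 2 : ℝ) + y * I) with hJ
  have hstep : ∀ k, J k = 2 * Real.pi * gTerm γ α x k + J (k + 1) := by
    intro k
    rw [← integral_line_shiftedIntegrand_sub hγ hα0 hα1 hx k, hJ]
    simp only [integral_line_shiftedIntegrand_succ hγ hα0 hα1 k]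
    ring
  have hsum : ∀ n, J 0 - J n = 2 * Real.pi * ∑ k ∈ Finset.range n, gTerm γ α x k := by
    intro n
    induction n with
    | zero => simp
    | succ n ih => rw [Finset.sum_range_succ, mul_add, ← ih]; linear_combination hstep n
  have hJ0 : Tendsto J atTop (𝓝 0) := by
    rw [← tendsto_add_atTop_iff_nat 1]
    refine (tendsto_integral_line_shiftedIntegrand hγ hα0 hα1 hx).congr fun k ↦ ?_
    exact (integral_line_shiftedIntegrand_succ hγ hα0 hα1 k).symm
  have h1 := (summable_gTerm hγ hα0 hα1 (x : ℂ)).hasSum.tendsto_sum_nat.const_mul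
    (2 * Real.pi : ℂ)
  have h2 : Tendsto (fun n ↦ J 0 - J n) atTop (𝓝 (J 0)) := by
    simpa using tendsto_const_nhds.sub hJ0
  have h3 := tendsto_nhds_unique (h2.congr hsum) h1
  have h4 : J 0 = ∫ y : ℝ, gIntegrand γ α x (c + y * I) := by
    simp only [hJ, shiftedIntegrand_zero]
    rcases le_total (1 / 2) c with h | h
    · exact integral_line_gIntegrand_eq hγ hα0 hα1 hx h (by norm_num) hc
    · exact (integral_line_gIntegrand_eq hγ hα0 hα1 hx h hc0 (by linarith)).symm
  rw [lineIntegral, integral_mul_const, ← h4, h3, g]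
  field_simp

/-! ### The Mellin transform of the density -/

open Set in
/-- A solution of the integral equation is continuous on `(0, ∞)`, by dominated convergence. -/
lemma IsDensity.continuousOn {γ α : ℝ} {h : ℝ → ℝ} (hh : IsDensity γ α h) (hγ : 0 < γ)
    (hα0 : 0 ≤ α) (hα1 : α < 1) : ContinuousOn h (Ioi 0) := by
  intro x₀ hx₀
  have hx₀' : 0 < x₀ := hx₀
  have hα : 0 < 1 - α := by linarith
  set φ : ℝ → ℝ → ℝ := fun x ↦ (Iic x).indicator fun u ↦ h u / (x - α * u) ^ γ with hφ
  have heq : ∀ x, 0 < x → h x = γ / x * ∫ u in Ioi (0 : ℝ), φ x u := by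
    intro x hx
    rw [hh.equation x hx, intervalIntegral.integral_of_le hx.le, hφ]
    simp only
    rw [setIntegral_indicator measurableSet_Iic, Ioi_inter_Iic]
  -- for `u ≤ x` and `x > x₀ / 2` the base `x - α u` is at least `(1 - α) x₀ / 2`
  have hev : ∀ᶠ x in 𝓝 x₀, x₀ / 2 < x := lt_mem_nhds (by linarith)
  have hc : ContinuousAt (fun x ↦ ∫ u in Ioi (0 : ℝ), φ x u) x₀ := by
    refine continuousAt_of_dominated (bound := fun u ↦ |h u| / ((1 - α) * (x₀ / 2)) ^ γ) ?_ ?_ ?_ ?_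
    · refine Eventually.of_forall fun x ↦ ?_
      refine AEStronglyMeasurable.indicator ?_ measurableSet_Iic
      refine AEMeasurable.aestronglyMeasurable ?_
      exact hh.integrable.aestronglyMeasurable.aemeasurable.div (by fun_prop)
    · filter_upwards [hev] with x hx
      filter_upwards [ae_restrict_mem measurableSet_Ioi] with u hu
      have hu0 : 0 < u := hu
      simp only [hφ, indicator]
      split_ifs with hux
      · have hux' : u ≤ x := hux
        have hb : (1 - α) * (x₀ / 2) ≤ x - α * u := by nlinarith
        have h0 : 0 < (1 - α) * (x₀ / 2) := by positivity
        rw [norm_div, Real.norm_eq_abs, Real.norm_eq_abs,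
          abs_of_nonneg (Real.rpow_nonneg (by linarith) _)]
        gcongr
      · simp only [norm_zero]; positivity
    · exact hh.integrable.abs.div_const _
    · have hne : ∀ᵐ u ∂(volume.restrict (Ioi (0 : ℝ))), u ≠ x₀ :=
        ae_restrict_of_ae (Measure.ae_ne volume x₀)
      filter_upwards [hne, ae_restrict_mem measurableSet_Ioi] with u hu hu0
      have hu0' : 0 < u := hu0
      rcases lt_or_gt_of_ne hu with hlt | hgt
      · have hpos : 0 < x₀ - α * u := by nlinarith
        have h1 : ContinuousAt (fun x ↦ h u / (x - α * u) ^ γ) x₀ := by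
          refine ContinuousAt.div continuousAt_const
            (ContinuousAt.rpow_const (by fun_prop) (Or.inl hpos.ne')) ?_
          exact (Real.rpow_pos_of_pos hpos _).ne'
        refine h1.congr ?_
        filter_upwards [lt_mem_nhds hlt] with x hx
        simp [hφ, hx.le]
      · refine (continuousAt_const (y := (0 : ℝ))).congr ?_
        filter_upwards [gt_mem_nhds hgt] with x hx
        simp [hφ, not_le.2 hx]
  have h2 : ContinuousAt (fun x ↦ γ / x * ∫ u in Ioi (0 : ℝ), φ x u) x₀ :=
    (continuousAt_const.div continuousAt_id hx₀'.ne').mul hc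
  refine (h2.congr ?_).continuousWithinAt
  filter_upwards [lt_mem_nhds hx₀'] with x hx
  exact (heq x hx).symm

/-- The equation rescaled to the unit interval. -/
lemma IsDensity.equation_unit {γ α : ℝ} {h : ℝ → ℝ} (hh : IsDensity γ α h) (hα0 : 0 ≤ α)
    (hα1 : α < 1) {x : ℝ} (hx : 0 < x) :
    h x = γ * x ^ (-γ) * ∫ v in Set.Ioc (0 : ℝ) 1, h (x * v) * (1 - α * v) ^ (-γ) := by
  have h1 := intervalIntegral.integral_comp_mul_left (a := 0) (b := 1)
    (fun u ↦ h u / (x - α * u) ^ γ) hx.ne'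
  rw [mul_zero, mul_one, smul_eq_mul, intervalIntegral.integral_of_le zero_le_one] at h1
  have h2 : ∀ v ∈ Set.Ioc (0 : ℝ) 1, h (x * v) / (x - α * (x * v)) ^ γ =
      x ^ (-γ) * (h (x * v) * (1 - α * v) ^ (-γ)) := by
    intro v hv
    have : 0 ≤ 1 - α * v := by nlinarith [hv.1, hv.2]
    rw [show x - α * (x * v) = x * (1 - α * v) by ring, Real.mul_rpow hx.le this,
      Real.rpow_neg hx.le, Real.rpow_neg this]
    ring
  rw [setIntegral_congr_fun measurableSet_Ioc h2, integral_const_mul] at h1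
  rw [mul_assoc, h1, ← mul_assoc, ← div_eq_mul_inv]
  exact hh.equation x hx

/-- The integrand of the double integral whose two iterated integrals relate the Mellin transform
of the density at `s` and at `s - γ`. -/
def mellinKernel (γ α : ℝ) (h : ℝ → ℝ) (s : ℂ) (x v : ℝ) : ℂ :=
  ((γ * (1 - α * v) ^ (-γ) : ℝ) : ℂ) * ((x : ℂ) ^ (s - γ - 1) * (h (v * x) : ℂ))

section

variable {γ α : ℝ} {h : ℝ → ℝ}

lemma one_sub_mul_pos (hα0 : 0 ≤ α) (hα1 : α < 1) {v : ℝ} (hv : v ∈ Set.Ioc (0 : ℝ) 1) :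
    0 < 1 - α * v := by nlinarith [hv.1, hv.2]

lemma aestronglyMeasurable_mellinKernel (hh : IsDensity γ α h) (hγ : 0 < γ)
    (hα0 : 0 ≤ α) (hα1 : α < 1) (s : ℂ) :
    AEStronglyMeasurable (fun p : ℝ × ℝ ↦ mellinKernel γ α h s p.1 p.2)
      ((volume.restrict (Set.Ioi 0)).prod (volume.restrict (Set.Ioc 0 1))) := by
  rw [Measure.prod_restrict]
  refine ContinuousOn.aestronglyMeasurable ?_ (measurableSet_Ioi.prod measurableSet_Ioc)
  unfold mellinKernel
  refine ContinuousOn.mul ?_ (ContinuousOn.mul ?_ ?_)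
  · refine continuous_ofReal.comp_continuousOn (ContinuousOn.mul continuousOn_const ?_)
    refine ContinuousOn.rpow_const (by fun_prop) fun p hp ↦ Or.inl ?_
    exact (one_sub_mul_pos hα0 hα1 hp.2).ne'
  · intro p hp
    have h1 : 0 < p.1 := hp.1
    exact ((continuousAt_ofReal_cpow_const _ _ (Or.inr h1.ne')).comp
      continuousAt_fst).continuousWithinAt
  · refine continuous_ofReal.comp_continuousOn ?_
    refine (hh.continuousOn hγ hα0 hα1).comp (f := fun p : ℝ × ℝ ↦ p.2 * p.1) (by fun_prop) ?_
    exact fun p hp ↦ mul_pos hp.2.1 hp.1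

lemma integrableOn_comp_mul (hh : IsDensity γ α h) {x : ℝ} (hx : 0 < x) :
    IntegrableOn (fun v ↦ h (x * v)) (Set.Ioc 0 1) := by
  have h1 : IntervalIntegrable h volume (x * 0) (x * 1) := by
    rw [mul_zero, mul_one, intervalIntegrable_iff_integrableOn_Ioc_of_le hx.le]
    exact hh.integrable.mono_set Set.Ioc_subset_Ioi_self
  have h2 := h1.comp_mul_left (c := x)
  rw [mul_div_cancel_left₀ _ hx.ne', mul_div_cancel_left₀ _ hx.ne',
    intervalIntegrable_iff_integrableOn_Ioc_of_le zero_le_one] at h2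
  exact h2

lemma continuousOn_one_sub_rpow (hα0 : 0 ≤ α) (hα1 : α < 1) :
    ContinuousOn (fun v : ℝ ↦ (1 - α * v) ^ (-γ)) (Set.Icc 0 1) :=
  ContinuousOn.rpow_const (by fun_prop) fun v hv ↦ Or.inl (by nlinarith [hv.1, hv.2])

lemma integrableOn_mul_one_sub_rpow (hα0 : 0 ≤ α) (hα1 : α < 1) {q : ℝ → ℝ}
    (hq : IntegrableOn q (Set.Ioc 0 1)) :
    IntegrableOn (fun v ↦ q v * (1 - α * v) ^ (-γ)) (Set.Ioc 0 1) := by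
  rw [← integrableOn_Icc_iff_integrableOn_Ioc] at hq ⊢
  exact hq.mul_continuousOn (continuousOn_one_sub_rpow hα0 hα1) isCompact_Icc

lemma integrable_mellinKernel_right (hh : IsDensity γ α h) (hα0 : 0 ≤ α) (hα1 : α < 1) (s : ℂ)
    {x : ℝ} (hx : 0 < x) : IntegrableOn (fun v ↦ mellinKernel γ α h s x v) (Set.Ioc 0 1) := by
  have h1 := (integrableOn_mul_one_sub_rpow (γ := γ) hα0 hα1 (integrableOn_comp_mul hh hx)).ofReal
    (𝕜 := ℂ)
  refine (h1.const_mul (γ * (x : ℂ) ^ (s - γ - 1))).congr (Eventually.of_forall fun v ↦ ?_)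
  simp only [mellinKernel, mul_comm x v, RCLike.ofReal_eq_complex_ofReal]
  push_cast
  ring

lemma integral_mellinKernel_right (hh : IsDensity γ α h) (hα0 : 0 ≤ α) (hα1 : α < 1) (s : ℂ)
    {x : ℝ} (hx : 0 < x) :
    ∫ v in Set.Ioc (0 : ℝ) 1, mellinKernel γ α h s x v = (x : ℂ) ^ (s - 1) * h x := by
  have hx0 : (x : ℂ) ≠ 0 := by exact_mod_cast hx.ne'
  have h1 : ∀ v : ℝ, mellinKernel γ α h s x v = γ * (x : ℂ) ^ (s - γ - 1) *
      ((h (x * v) * (1 - α * v) ^ (-γ) : ℝ) : ℂ) := by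
    intro v
    simp only [mellinKernel, mul_comm x v]
    push_cast
    ring
  simp only [h1]
  rw [integral_const_mul, integral_complex_ofReal, hh.equation_unit hα0 hα1 hx,
    show s - γ - 1 = (s - 1) + (-γ : ℝ) by push_cast; ring, cpow_add _ _ hx0, ← ofReal_cpow hx.le]
  push_cast
  ring

lemma norm_mellinKernel (hh : IsDensity γ α h) (hγ : 0 < γ) (hα0 : 0 ≤ α) (hα1 : α < 1) (s : ℂ)
    {x v : ℝ} (hx : 0 < x) (hv : v ∈ Set.Ioc (0 : ℝ) 1) :
    (‖mellinKernel γ α h s x v‖ : ℂ) = mellinKernel γ α h (s.re : ℂ) x v := by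
  have h1 := one_sub_mul_pos hα0 hα1 hv
  have h2 := hh.nonneg (v * x) (mul_pos hv.1 hx)
  have h3 : 0 ≤ γ * (1 - α * v) ^ (-γ) := by positivity
  rw [mellinKernel, mellinKernel, norm_mul, norm_mul, norm_real, norm_real, Real.norm_of_nonneg h2,
    Real.norm_of_nonneg h3, norm_cpow_eq_rpow_re_of_pos hx]
  push_cast
  rw [ofReal_cpow hx.le]
  simp

lemma integral_norm_mellinKernel_right (hh : IsDensity γ α h) (hγ : 0 < γ) (hα0 : 0 ≤ α)
    (hα1 : α < 1) (s : ℂ) {x : ℝ} (hx : 0 < x) :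
    ∫ v in Set.Ioc (0 : ℝ) 1, ‖mellinKernel γ α h s x v‖ = ‖(x : ℂ) ^ (s - 1) * h x‖ := by
  rw [← ofReal_inj, ← integral_complex_ofReal,
    setIntegral_congr_fun measurableSet_Ioc fun v hv ↦ norm_mellinKernel hh hγ hα0 hα1 s hx hv,
    integral_mellinKernel_right hh hα0 hα1 _ hx, norm_mul, norm_cpow_eq_rpow_re_of_pos hx,
    norm_real, Real.norm_of_nonneg (hh.nonneg x hx)]
  push_cast
  rw [ofReal_cpow hx.le]
  simp

lemma integrable_mellinKernel_of_mellinConvergent (hh : IsDensity γ α h) (hγ : 0 < γ)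
    (hα0 : 0 ≤ α) (hα1 : α < 1) {s : ℂ} (hs : MellinConvergent (fun x ↦ (h x : ℂ)) s) :
    Integrable (fun p : ℝ × ℝ ↦ mellinKernel γ α h s p.1 p.2)
      ((volume.restrict (Set.Ioi 0)).prod (volume.restrict (Set.Ioc 0 1))) := by
  rw [integrable_prod_iff (aestronglyMeasurable_mellinKernel hh hγ hα0 hα1 s)]
  constructor
  · filter_upwards [ae_restrict_mem measurableSet_Ioi] with x hx
    exact integrable_mellinKernel_right hh hα0 hα1 s hx
  · refine (Integrable.norm hs).congr ?_
    filter_upwards [ae_restrict_mem measurableSet_Ioi] with x hx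
    rw [integral_norm_mellinKernel_right hh hγ hα0 hα1 s hx, smul_eq_mul]

/-- Convergence of the Mellin transform at `s` forces convergence at `s - γ`: both belong to one
double integral of a nonnegative function. -/
lemma IsDensity.mellinConvergent_sub (hh : IsDensity γ α h) (hγ : 0 < γ)
    (hα0 : 0 ≤ α) (hα1 : α < 1) {s : ℂ} (hs : MellinConvergent (fun x ↦ (h x : ℂ)) s) :
    MellinConvergent (fun x ↦ (h x : ℂ)) (s - γ) := by
  have h1 := (integrable_mellinKernel_of_mellinConvergent hh hγ hα0 hα1 hs).prod_left_ae
  have : (ae (volume.restrict (Set.Ioc (0 : ℝ) 1))).NeBot := by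
    rw [ae_neBot, Ne, Measure.restrict_eq_zero]
    simp
  obtain ⟨v, hv, hv1⟩ := (h1.and (ae_restrict_mem measurableSet_Ioc)).exists
  have h2 := one_sub_mul_pos hα0 hα1 hv1
  have hne : ((γ * (1 - α * v) ^ (-γ) : ℝ) : ℂ) ≠ 0 := by
    have : 0 < γ * (1 - α * v) ^ (-γ) := by positivity
    exact_mod_cast this.ne'
  simp only [mellinKernel] at hv
  rw [integrable_const_mul_iff hne.isUnit] at hv
  exact (MellinConvergent.comp_mul_left (f := fun x ↦ (h x : ℂ)) hv1.1).1 hv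

/-- Convergence of the Mellin transform at `s - γ` gives convergence at `s` as long as
`v ^ (γ - s)` is integrable at `0`. -/
lemma integrable_mellinKernel_of_mellinConvergent_sub (hh : IsDensity γ α h) (hγ : 0 < γ)
    (hα0 : 0 ≤ α) (hα1 : α < 1) {s : ℂ} (hs1 : s.re < 1 + γ)
    (hs : MellinConvergent (fun x ↦ (h x : ℂ)) (s - γ)) :
    Integrable (fun p : ℝ × ℝ ↦ mellinKernel γ α h s p.1 p.2)
      ((volume.restrict (Set.Ioi 0)).prod (volume.restrict (Set.Ioc 0 1))) := by
  rw [integrable_prod_iff' (aestronglyMeasurable_mellinKernel hh hγ hα0 hα1 s)]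
  constructor
  · filter_upwards [ae_restrict_mem measurableSet_Ioc] with v hv
    exact Integrable.const_mul
      ((MellinConvergent.comp_mul_left (f := fun x ↦ (h x : ℂ)) hv.1).2 hs) _
  · set Q := ∫ x in Set.Ioi (0 : ℝ), ‖(x : ℂ) ^ (s - γ - 1) * (h x : ℂ)‖ with hQ
    have hnorm : ∀ v ∈ Set.Ioc (0 : ℝ) 1, ∫ x in Set.Ioi (0 : ℝ), ‖mellinKernel γ α h s x v‖ =
        γ * Q * (v ^ (γ - s.re) * (1 - α * v) ^ (-γ)) := by
      intro v hv
      have hv0 := hv.1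
      have h2 := one_sub_mul_pos hα0 hα1 hv
      have h3 : 0 ≤ γ * (1 - α * v) ^ (-γ) := by positivity
      have e : ∀ x ∈ Set.Ioi (0 : ℝ), ‖mellinKernel γ α h s x v‖ =
          γ * (1 - α * v) ^ (-γ) * v ^ (γ + 1 - s.re) *
            ‖((v * x : ℝ) : ℂ) ^ (s - γ - 1) * (h (v * x) : ℂ)‖ := by
        intro x hx
        have hx0 : 0 < x := hx
        rw [mellinKernel, norm_mul, norm_mul, norm_mul, norm_real, Real.norm_of_nonneg h3,
          norm_cpow_eq_rpow_re_of_pos hx, norm_cpow_eq_rpow_re_of_pos (mul_pos hv0 hx0),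
          Real.mul_rpow hv0.le hx0.le]
        have : v ^ (γ + 1 - s.re) * v ^ (s - γ - 1 : ℂ).re = 1 := by
          rw [← Real.rpow_add hv0, sub_re, sub_re, ofReal_re, one_re,
              show γ + 1 - s.re + (s.re - γ - 1) = 0 by ring, Real.rpow_zero]
        linear_combination -γ * (1 - α * v) ^ (-γ) * x ^ (s - γ - 1 : ℂ).re *
          ‖(h (v * x) : ℂ)‖ * this
      rw [setIntegral_congr_fun measurableSet_Ioi e, integral_const_mul,
        integral_comp_mul_left_Ioi (fun u : ℝ ↦ ‖(u : ℂ) ^ (s - γ - 1) * (h u : ℂ)‖) 0 hv0,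
        mul_zero, ← hQ, smul_eq_mul, show γ + 1 - s.re = γ - s.re + 1 by ring,
        Real.rpow_add_one hv0.ne']
      field_simp
    have hi : IntegrableOn (fun v : ℝ ↦ v ^ (γ - s.re)) (Set.Ioc 0 1) := by
      rw [← intervalIntegrable_iff_integrableOn_Ioc_of_le zero_le_one]
      exact intervalIntegral.intervalIntegrable_rpow' (by linarith)
    refine ((integrableOn_mul_one_sub_rpow (γ := γ) hα0 hα1 hi).const_mul (γ * Q)).congr ?_
    filter_upwards [ae_restrict_mem measurableSet_Ioc] with v hv
    exact (hnorm v hv).symm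

lemma IsDensity.mellinConvergent_of_sub (hh : IsDensity γ α h) (hγ : 0 < γ)
    (hα0 : 0 ≤ α) (hα1 : α < 1) {s : ℂ} (hs1 : s.re < 1 + γ)
    (hs : MellinConvergent (fun x ↦ (h x : ℂ)) (s - γ)) :
    MellinConvergent (fun x ↦ (h x : ℂ)) s := by
  have h1 :=
    (integrable_mellinKernel_of_mellinConvergent_sub hh hγ hα0 hα1 hs1 hs).integral_prod_left
  refine h1.congr ?_
  filter_upwards [ae_restrict_mem measurableSet_Ioi] with x hx
  rw [integral_mellinKernel_right hh hα0 hα1 s hx, smul_eq_mul]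

/-- The functional equation of the Mellin transform of the density. -/
lemma IsDensity.mellin_eq (hh : IsDensity γ α h) (hγ : 0 < γ)
    (hα0 : 0 ≤ α) (hα1 : α < 1) {s : ℂ} (hs1 : s.re < 1 + γ)
    (hs : MellinConvergent (fun x ↦ (h x : ℂ)) (s - γ)) :
    mellin (fun x ↦ (h x : ℂ)) s = γ * (hyp γ α (1 + γ - s) / (1 + γ - s)) *
      mellin (fun x ↦ (h x : ℂ)) (s - γ) := by
  have hswap := integral_integral_swap (f := mellinKernel γ α h s)
    (integrable_mellinKernel_of_mellinConvergent_sub hh hγ hα0 hα1 hs1 hs)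
  have e1 : ∫ x in Set.Ioi (0 : ℝ), ∫ v in Set.Ioc (0 : ℝ) 1, mellinKernel γ α h s x v =
      mellin (fun x ↦ (h x : ℂ)) s :=
    setIntegral_congr_fun measurableSet_Ioi fun x hx ↦ by
      simpa using integral_mellinKernel_right hh hα0 hα1 s hx
  have e2 : ∫ v in Set.Ioc (0 : ℝ) 1, ∫ x in Set.Ioi (0 : ℝ), mellinKernel γ α h s x v =
      ∫ v in Set.Ioc (0 : ℝ) 1, γ * mellin (fun x ↦ (h x : ℂ)) (s - γ) *
        ((v : ℂ) ^ (1 + γ - s - 1) * (((1 - α * v) ^ (-γ) : ℝ) : ℂ)) := by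
    refine setIntegral_congr_fun measurableSet_Ioc fun v hv ↦ ?_
    have := mellin_comp_mul_left (fun x ↦ (h x : ℂ)) (s - γ) hv.1
    simp only [mellin, smul_eq_mul] at this
    simp only [mellinKernel]
    rw [integral_const_mul, this, show (1 : ℂ) + γ - s - 1 = -(s - γ) by ring, mellin]
    simp only [smul_eq_mul]
    push_cast
    ring
  rw [e1, e2, integral_const_mul, integral_cpow_mul_one_sub_rpow hγ hα0 hα1
    (by simp; linarith)] at hswap
  rw [hswap]
  ring

lemma IsDensity.mellinConvergent_one (hh : IsDensity γ α h) :
    MellinConvergent (fun x ↦ (h x : ℂ)) 1 := by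
  rw [MellinConvergent]
  simpa using! hh.integrable.ofReal (𝕜 := ℂ)

/-- From `s = 1`, where it holds by hypothesis, convergence reaches every `1 - n γ`, then by
domination the half-plane `Re s ≤ 1`, and by one step of `γ` to the right the half-plane `Re s < 1 + γ`. -/
lemma IsDensity.mellinConvergent (hh : IsDensity γ α h) (hγ : 0 < γ)
    (hα0 : 0 ≤ α) (hα1 : α < 1) {s : ℂ} (hs : s.re < 1 + γ) :
    MellinConvergent (fun x ↦ (h x : ℂ)) s := by
  have hnat : ∀ n : ℕ, MellinConvergent (fun x ↦ (h x : ℂ)) (1 - n * γ) := by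
    intro n
    induction n with
    | zero => simpa using hh.mellinConvergent_one
    | succ n ih =>
      convert hh.mellinConvergent_sub hγ hα0 hα1 ih using 1
      push_cast; ring
  -- to the left of `1` the power `x ^ (s - 1)` is dominated by `1 + x ^ (-n γ)` for large `n`
  have hleft : ∀ s : ℂ, s.re ≤ 1 → MellinConvergent (fun x ↦ (h x : ℂ)) s := by
    intro s hs
    obtain ⟨n, hn⟩ := exists_nat_ge ((1 - s.re) / γ)
    rw [div_le_iff₀ hγ] at hn
    refine Integrable.mono' ((Integrable.norm hh.mellinConvergent_one).add
      (Integrable.norm (hnat n))) ?_ ?_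
    · refine ContinuousOn.aestronglyMeasurable (ContinuousOn.fun_smul ?_ ?_) measurableSet_Ioi
      · intro x hx
        have h1 : 0 < x := hx
        exact (continuousAt_ofReal_cpow_const _ _ (Or.inr h1.ne')).continuousWithinAt
      · exact continuous_ofReal.comp_continuousOn (hh.continuousOn hγ hα0 hα1)
    · filter_upwards [ae_restrict_mem measurableSet_Ioi] with x hx
      have hx0 : 0 < x := hx
      simp only [Pi.add_apply, norm_smul, norm_cpow_eq_rpow_re_of_pos hx0]
      rw [← add_mul]
      refine mul_le_mul_of_nonneg_right ?_ (norm_nonneg _)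
      simp only [sub_re, one_re, mul_re, natCast_re, ofReal_re, natCast_im, ofReal_im, mul_zero,
        sub_zero, sub_self, zero_re, Real.rpow_zero]
      rcases le_total 1 x with h1 | h1
      · exact (Real.rpow_le_one_of_one_le_of_nonpos h1 (by linarith)).trans
          (le_add_of_nonneg_right (Real.rpow_nonneg hx0.le _))
      · exact (Real.rpow_le_rpow_of_exponent_ge hx0 h1 (by linarith)).trans
          (le_add_of_nonneg_left zero_le_one)
  exact hh.mellinConvergent_of_sub hγ hα0 hα1 hs (hleft _ (by simp; linarith))

end

/-! ### The moments of the density -/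

/-- For `0 ≤ Re z ≤ 1` the function `u ↦ u ^ z` deviates from its value at `1` at most linearly,
uniformly on `(0, ∞)`. -/
lemma norm_cpow_sub_one_le {z : ℂ} (hz0 : 0 ≤ z.re) (hz1 : z.re ≤ 1) {u : ℝ} (hu : 0 < u) :
    ‖(u : ℂ) ^ z - 1‖ ≤ (2 * ‖z‖ + 4) * |u - 1| := by
  rcases eq_or_ne z 0 with rfl | hz
  · simp only [cpow_zero, sub_self, norm_zero]; positivity
  rcases lt_or_ge u (1 / 2) with h | h
  · have h1 : ‖(u : ℂ) ^ z‖ ≤ 1 := by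
      rw [norm_cpow_eq_rpow_re_of_pos hu]
      exact Real.rpow_le_one hu.le (by linarith) hz0
    have h2 : 1 / 2 ≤ |u - 1| := by rw [abs_sub_comm]; exact le_trans (by linarith) (le_abs_self _)
    have h3 := norm_sub_le ((u : ℂ) ^ z) 1
    rw [norm_one] at h3
    nlinarith [norm_nonneg z]
  · have hmv := Convex.norm_image_sub_le_of_norm_hasDerivWithin_le (𝕜 := ℝ)
      (f := fun v : ℝ ↦ (v : ℂ) ^ z)
      (f' := fun v ↦ z * (v : ℂ) ^ (z - 1)) (s := Set.Ici (1 / 2)) (C := ‖z‖ * 2)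
      (fun v hv ↦ by
        have hv' : 1 / 2 ≤ v := hv
        exact (hasDerivAt_ofReal_cpow_const (by linarith) hz).hasDerivWithinAt)
      (fun v hv ↦ by
        have hv' : 1 / 2 ≤ v := hv
        rw [norm_mul, norm_cpow_eq_rpow_re_of_pos (by linarith)]
        gcongr
        calc v ^ (z - 1).re ≤ (1 / 2 : ℝ) ^ (z - 1).re :=
              Real.rpow_le_rpow_of_nonpos (by norm_num) hv' (by simpa using hz1)
          _ ≤ (1 / 2 : ℝ) ^ (-1 : ℝ) :=
              Real.rpow_le_rpow_of_exponent_ge (by norm_num) (by norm_num) (by simpa using hz0)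
          _ = 2 := by rw [Real.rpow_neg_one]; norm_num)
      (convex_Ici _) (x := 1) (y := u) (by norm_num) h
    simp only [ofReal_one, one_cpow, Real.norm_eq_abs] at hmv
    refine hmv.trans ?_
    gcongr
    linarith

/-- The moments `E[(X ^ (-γ)) ^ z]` of a random variable `X` with density `h`. -/
def moment (γ : ℝ) (h : ℝ → ℝ) (z : ℂ) : ℂ := mellin (fun x ↦ (h x : ℂ)) (1 - γ * z)

/-- The moments of `X ^ (-γ)` of natural order, as real numbers. -/
def natMoment (γ : ℝ) (h : ℝ → ℝ) (n : ℕ) : ℝ := ∫ x in Set.Ioi (0 : ℝ), x ^ (-(γ * n)) * h x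

section

variable {γ α : ℝ} {h : ℝ → ℝ}

lemma one_sub_mul_re_lt (hγ : 0 < γ) {z : ℂ} (hz : -1 < z.re) : (1 - γ * z : ℂ).re < 1 + γ := by
  simp
  nlinarith

lemma cpow_smul_eq_mul_cpow {x : ℝ} (hx : 0 < x) (n : ℕ) (z : ℂ) (y : ℝ) :
    (x : ℂ) ^ (1 - γ * (n + z) - 1) • (y : ℂ) =
      ((x ^ (-(γ * n)) * y : ℝ) : ℂ) * ((x ^ (-γ) : ℝ) : ℂ) ^ z := by
  have hx0 : (x : ℂ) ≠ 0 := by exact_mod_cast hx.ne'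
  rw [← cpow_mul_ofReal_nonneg hx.le,
    show (1 : ℂ) - γ * (n + z) - 1 = (-(γ * n) : ℝ) + (-γ : ℝ) * z by push_cast; ring,
    cpow_add _ _ hx0, ← ofReal_cpow hx.le, smul_eq_mul]
  push_cast
  ring

lemma moment_natCast (γ : ℝ) (h : ℝ → ℝ) (n : ℕ) : moment γ h n = natMoment γ h n := by
  rw [moment, mellin, natMoment, ← integral_complex_ofReal]
  refine setIntegral_congr_fun measurableSet_Ioi fun x hx ↦ ?_
  have := cpow_smul_eq_mul_cpow (γ := γ) hx n 0 (h x)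
  rwa [add_zero, cpow_zero, mul_one] at this

lemma integrableOn_natMoment (hh : IsDensity γ α h) (hγ : 0 < γ) (hα0 : 0 ≤ α) (hα1 : α < 1)
    (n : ℕ) : IntegrableOn (fun x ↦ x ^ (-(γ * n)) * h x) (Set.Ioi 0) := by
  have h1 : MellinConvergent (fun x ↦ (h x : ℂ)) (1 - γ * n) :=
    hh.mellinConvergent hγ hα0 hα1 (one_sub_mul_re_lt hγ (by
      simp; linarith [Nat.cast_nonneg (α := ℝ) n]))
  refine (Integrable.re h1).congr ?_
  filter_upwards [ae_restrict_mem measurableSet_Ioi] with x hx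
  have := cpow_smul_eq_mul_cpow (γ := γ) hx n 0 (h x)
  rw [add_zero, cpow_zero, mul_one] at this
  rw [this]
  exact ofReal_re _

lemma moment_zero (hh : IsDensity γ α h) : moment γ h 0 = 1 := by
  have := moment_natCast γ h 0
  rw [Nat.cast_zero] at this
  rw [this, natMoment]
  simpa using hh.normalised

/-- The functional equation of the moments. -/
lemma moment_recurrence (hh : IsDensity γ α h) (hγ : 0 < γ) (hα0 : 0 ≤ α) (hα1 : α < 1) {z : ℂ}
    (hz : -1 < z.re) : (z + 1) * moment γ h z = F γ α (z + 1) * moment γ h (z + 1) := by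
  have hγ0 : (γ : ℂ) ≠ 0 := by exact_mod_cast hγ.ne'
  have hz0 : z + 1 ≠ 0 := fun h0 ↦ by
    have := congrArg re h0
    simp at this
    linarith
  have hs : (1 - γ * z - γ : ℂ) = 1 - γ * (z + 1) := by ring
  have h1 := hh.mellin_eq hγ hα0 hα1 (one_sub_mul_re_lt hγ hz)
    (by rw [hs]; exact hh.mellinConvergent hγ hα0 hα1 (one_sub_mul_re_lt hγ (by simp; linarith)))
  rw [hs, show (1 + γ - (1 - γ * z) : ℂ) = (z + 1) * γ by ring, ← F_eq_hyp] at h1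
  rw [moment, h1, moment]
  field_simp

lemma natMoment_nonneg (hh : IsDensity γ α h) (n : ℕ) : 0 ≤ natMoment γ h n :=
  setIntegral_nonneg measurableSet_Ioi fun x hx ↦
    mul_nonneg (Real.rpow_nonneg (le_of_lt hx) _) (hh.nonneg x hx)

lemma natMoment_pos (hh : IsDensity γ α h) (hγ : 0 < γ) (hα0 : 0 ≤ α) (hα1 : α < 1)
    (n : ℕ) : 0 < natMoment γ h n := by
  refine (natMoment_nonneg hh n).lt_of_ne' ?_
  rw [← ofReal_ne_zero, ← moment_natCast]
  induction n with
  | zero => simp [moment_zero hh]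
  | succ n ih =>
    have hn : -1 < (n : ℂ).re := by simp; linarith [Nat.cast_nonneg (α := ℝ) n]
    have h1 := moment_recurrence hh hγ hα0 hα1 hn
    push_cast
    intro h0
    rw [h0, mul_zero] at h1
    exact mul_ne_zero (Nat.cast_add_one_ne_zero n) ih h1

/-- The ratio of consecutive moments: the mean of `X ^ (-γ)` under the measure with density
proportional to `x ^ (-γ n) h x`. -/
def momentRatio (γ : ℝ) (h : ℝ → ℝ) (n : ℕ) : ℝ := natMoment γ h (n + 1) / natMoment γ h n

lemma momentRatio_pos (hh : IsDensity γ α h) (hγ : 0 < γ) (hα0 : 0 ≤ α) (hα1 : α < 1)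
    (n : ℕ) : 0 < momentRatio γ h n :=
  div_pos (natMoment_pos hh hγ hα0 hα1 _) (natMoment_pos hh hγ hα0 hα1 _)

lemma momentRatio_eq (hh : IsDensity γ α h) (hγ : 0 < γ) (hα0 : 0 ≤ α) (hα1 : α < 1)
    (n : ℕ) : momentRatio γ h n = (n + 1) / ‖F γ α (n + 1)‖ := by
  have hn : -1 < (n : ℂ).re := by simp; linarith [Nat.cast_nonneg (α := ℝ) n]
  have h1 := congrArg norm (moment_recurrence hh hγ hα0 hα1 hn)
  have h2 := moment_natCast γ h (n + 1)
  push_cast at h2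
  have h3 := natMoment_pos hh hγ hα0 hα1 n
  have h4 := natMoment_pos hh hγ hα0 hα1 (n + 1)
  have h5 : 0 < ‖F γ α (n + 1)‖ := by
    have := norm_F_natCast_ge hγ hα0 hα1 (n + 1)
    push_cast at this
    linarith
  rw [norm_mul, norm_mul, moment_natCast, h2, norm_real, norm_real, Real.norm_of_nonneg h3.le,
    Real.norm_of_nonneg h4.le] at h1
  have h6 : ‖(n : ℂ) + 1‖ = n + 1 := by
    have := Complex.norm_natCast (n + 1)
    push_cast at this
    exact this
  rw [h6] at h1
  rw [momentRatio, div_eq_div_iff h3.ne' h5.ne', h1]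
  ring

lemma tendsto_momentRatio_div (hh : IsDensity γ α h) (hγ : 0 < γ) (hα0 : 0 ≤ α) (hα1 : α < 1) :
    Tendsto (fun n : ℕ ↦ momentRatio γ h n / n) atTop (𝓝 ((1 - α) ^ γ)) := by
  have hp : 0 < 1 - α := by linarith
  have h1 := (tendsto_F_natCast_add hγ hα0 hα1 1).norm
  rw [norm_real, Real.norm_of_nonneg (by positivity)] at h1
  have h2 : Tendsto (fun n : ℕ ↦ (1 : ℝ) + 1 / n) atTop (𝓝 (1 + 0)) :=
    tendsto_one_div_atTop_nhds_zero_nat.const_add 1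
  have h3 := h2.div h1 (by positivity)
  rw [Real.rpow_neg hp.le, add_zero, one_div, inv_inv] at h3
  refine h3.congr' ?_
  filter_upwards [eventually_ne_atTop 0] with n hn
  have hn' : (n : ℝ) ≠ 0 := by exact_mod_cast hn
  rw [momentRatio_eq hh hγ hα0 hα1, Pi.div_apply]
  field_simp

lemma tendsto_momentRatio_succ_div (hh : IsDensity γ α h) (hγ : 0 < γ) (hα0 : 0 ≤ α)
    (hα1 : α < 1) :
    Tendsto (fun n : ℕ ↦ momentRatio γ h (n + 1) / momentRatio γ h n) atTop (𝓝 1) := by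
  have hp : 0 < 1 - α := by linarith
  have h1 := tendsto_momentRatio_div hh hγ hα0 hα1
  have h2 : Tendsto (fun n : ℕ ↦ (1 : ℝ) + 1 / n) atTop (𝓝 (1 + 0)) :=
    tendsto_one_div_atTop_nhds_zero_nat.const_add 1
  have h3 := (((tendsto_add_atTop_iff_nat 1).2 h1).mul h2).div h1 (by positivity)
  rw [add_zero, mul_one, div_self (by positivity)] at h3
  refine h3.congr' ?_
  filter_upwards [eventually_ne_atTop 0] with n hn
  have hn' : (n : ℝ) ≠ 0 := by exact_mod_cast hn
  have := (momentRatio_pos hh hγ hα0 hα1 n).ne'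
  simp only [Pi.div_apply]
  push_cast
  field_simp

/-- The variance of `X ^ (-γ)` under the tilted measure controls how well the moments of fractional
order are approximated by powers of the mean. -/
lemma norm_moment_div_sub_one_le (hh : IsDensity γ α h) (hγ : 0 < γ) (hα0 : 0 ≤ α) (hα1 : α < 1)
    {z : ℂ} (hz0 : 0 ≤ z.re) (hz1 : z.re ≤ 1) (n : ℕ) {ε : ℝ} (hε : 0 < ε) :
    ‖moment γ h (n + z) / (natMoment γ h n * (momentRatio γ h n : ℂ) ^ z) - 1‖ ≤
      (2 * ‖z‖ + 4) * (ε + (momentRatio γ h (n + 1) / momentRatio γ h n - 1) / ε) := by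
  set m := momentRatio γ h n with hm
  set C := 2 * ‖z‖ + 4 with hC
  have hm0 : 0 < m := momentRatio_pos hh hγ hα0 hα1 n
  have hw := natMoment_pos hh hγ hα0 hα1
  have hC0 : 0 ≤ C := by positivity
  have hmz : (m : ℂ) ^ z ≠ 0 := by
    rw [Ne, cpow_eq_zero_iff, not_and_or]; exact Or.inl (by exact_mod_cast hm0.ne')
  have hw0 : (natMoment γ h n : ℂ) ≠ 0 := by exact_mod_cast (hw n).ne'
  have hI := integrableOn_natMoment hh hγ hα0 hα1
  set P : ℝ → ℝ := fun x ↦ x ^ (-(γ * n)) * h x with hP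
  -- the second-order polynomial in `x ^ (-γ) / m` whose integral is the variance
  set Q : ℝ → ℝ := fun x ↦ P x * (x ^ (-γ) / m - 1) ^ 2 with hQ
  have hshift : ∀ x : ℝ, 0 < x → ∀ k : ℕ,
      x ^ (-(γ * (n + k : ℕ))) * h x = P x * (x ^ (-γ)) ^ k := by
    intro x hx k
    rw [hP]
    simp only
    rw [← Real.rpow_mul_natCast hx.le, mul_right_comm, ← Real.rpow_add hx]
    push_cast
    ring_nf
  have hQe : ∀ x ∈ Set.Ioi (0 : ℝ), Q x = (m ^ 2)⁻¹ * (x ^ (-(γ * (n + 2 : ℕ))) * h x) -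
      2 * m⁻¹ * (x ^ (-(γ * (n + 1 : ℕ))) * h x) + P x := by
    intro x hx
    rw [hshift x hx 2, hshift x hx 1, hQ]
    field_simp
    ring
  have hPi : IntegrableOn P (Set.Ioi 0) := hI n
  have hsub : IntegrableOn (fun x ↦ (m ^ 2)⁻¹ * (x ^ (-(γ * (n + 2 : ℕ))) * h x) -
      2 * m⁻¹ * (x ^ (-(γ * (n + 1 : ℕ))) * h x)) (Set.Ioi 0) :=
    ((hI (n + 2)).const_mul (m ^ 2)⁻¹).sub ((hI (n + 1)).const_mul (2 * m⁻¹))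
  have hQi : IntegrableOn Q (Set.Ioi 0) :=
    IntegrableOn.congr_fun (hsub.add hPi) (fun x hx ↦ (hQe x hx).symm) measurableSet_Ioi
  have hm' : momentRatio γ h (n + 1) = natMoment γ h (n + 2) / natMoment γ h (n + 1) := rfl
  have hmdef : m = natMoment γ h (n + 1) / natMoment γ h n := rfl
  have hQv : ∫ x in Set.Ioi (0 : ℝ), Q x =
      natMoment γ h n * (momentRatio γ h (n + 1) / m - 1) := by
    rw [setIntegral_congr_fun measurableSet_Ioi hQe, integral_add hsub hPi,
      integral_sub ((hI (n + 2)).const_mul (m ^ 2)⁻¹) ((hI (n + 1)).const_mul (2 * m⁻¹)),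
      integral_const_mul, integral_const_mul]
    change (m ^ 2)⁻¹ * natMoment γ h (n + 2) - 2 * m⁻¹ * natMoment γ h (n + 1) +
      natMoment γ h n = _
    have h1 := (hw (n + 1)).ne'
    have h2 := (hw n).ne'
    rw [hm', hmdef]
    field_simp
    ring
  have hdiff : moment γ h (n + z) / (natMoment γ h n * (m : ℂ) ^ z) - 1 =
      (natMoment γ h n : ℂ)⁻¹ * ∫ x in Set.Ioi (0 : ℝ),
        (P x : ℂ) * (((x ^ (-γ) / m : ℝ) : ℂ) ^ z - 1) := by
    have e : ∀ x ∈ Set.Ioi (0 : ℝ), (P x : ℂ) * (((x ^ (-γ) / m : ℝ) : ℂ) ^ z - 1) =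
        ((m : ℂ) ^ z)⁻¹ * ((x : ℂ) ^ (1 - γ * (n + z) - 1) • (h x : ℂ)) - (P x : ℂ) := by
      intro x hx
      have hx0 : 0 < x := hx
      have h1 : (x ^ (-γ) / m) * m = x ^ (-γ) := div_mul_cancel₀ _ hm0.ne'
      rw [cpow_smul_eq_mul_cpow hx, ← h1, ofReal_mul (x ^ (-γ) / m) m,
        mul_cpow_ofReal_nonneg (by positivity) hm0.le]
      simp only [hP]
      rw [h1]
      field_simp
    have i1 : MellinConvergent (fun x ↦ (h x : ℂ)) (1 - γ * (n + z)) :=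
      hh.mellinConvergent hγ hα0 hα1 (one_sub_mul_re_lt hγ (by
        simp; linarith [Nat.cast_nonneg (α := ℝ) n]))
    have i2 : IntegrableOn (fun x ↦ (P x : ℂ)) (Set.Ioi 0) := (hI n).ofReal
    rw [setIntegral_congr_fun measurableSet_Ioi e, integral_sub (Integrable.const_mul i1 _) i2,
      integral_const_mul, integral_complex_ofReal]
    change _ = (natMoment γ h n : ℂ)⁻¹ * (((m : ℂ) ^ z)⁻¹ * moment γ h (n + z) - natMoment γ h n)
    field_simp
  rw [hdiff, norm_mul, norm_inv, norm_real, Real.norm_of_nonneg (hw n).le,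
    inv_mul_le_iff₀ (hw n)]
  have hbound : ‖∫ x in Set.Ioi (0 : ℝ), (P x : ℂ) * (((x ^ (-γ) / m : ℝ) : ℂ) ^ z - 1)‖ ≤
      ∫ x in Set.Ioi (0 : ℝ), C * (ε * P x + ε⁻¹ * Q x) := by
    refine norm_integral_le_of_norm_le ((((hI n).const_mul ε).add (hQi.const_mul ε⁻¹)).const_mul C)
      ?_
    filter_upwards [ae_restrict_mem measurableSet_Ioi] with x hx
    have hx0 : 0 < x := hx
    have hP0 : 0 ≤ P x := mul_nonneg (Real.rpow_nonneg hx0.le _) (hh.nonneg x hx)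
    have h1 := norm_cpow_sub_one_le hz0 hz1 (u := x ^ (-γ) / m) (by positivity)
    -- an inequality of Chebyshev type that turns the first-order deviation into the variance
    have h2 : |x ^ (-γ) / m - 1| ≤ ε + ε⁻¹ * (x ^ (-γ) / m - 1) ^ 2 := by
      rw [← sq_abs]
      generalize |x ^ (-γ) / m - 1| = a
      rw [← sub_nonneg]
      have : ε + ε⁻¹ * a ^ 2 - a = ε⁻¹ * ((ε - a / 2) ^ 2 + 3 / 4 * a ^ 2) := by
        field_simp; ring
      rw [this]; positivity
    rw [norm_mul, norm_real, Real.norm_of_nonneg hP0]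
    calc P x * ‖((x ^ (-γ) / m : ℝ) : ℂ) ^ z - 1‖
        ≤ P x * (C * (ε + ε⁻¹ * (x ^ (-γ) / m - 1) ^ 2)) :=
          mul_le_mul_of_nonneg_left (h1.trans (mul_le_mul_of_nonneg_left h2 hC0)) hP0
      _ = C * (ε * P x + ε⁻¹ * Q x) := by rw [hQ]; ring
  refine hbound.trans (le_of_eq ?_)
  rw [integral_const_mul, integral_add ((hI n).const_mul ε) (hQi.const_mul ε⁻¹),
    integral_const_mul, integral_const_mul, hQv]
  change C * (ε * natMoment γ h n + _) = _
  ring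

/-- Concentration: the tilted measures make moments of fractional order asymptotic to powers of the
mean. -/
lemma tendsto_moment_div (hh : IsDensity γ α h) (hγ : 0 < γ) (hα0 : 0 ≤ α) (hα1 : α < 1)
    {z : ℂ} (hz0 : 0 ≤ z.re) (hz1 : z.re ≤ 1) :
    Tendsto (fun n : ℕ ↦ moment γ h (n + z) / (natMoment γ h n * (momentRatio γ h n : ℂ) ^ z))
      atTop (𝓝 1) := by
  rw [tendsto_iff_norm_sub_tendsto_zero]
  set v : ℕ → ℝ := fun n ↦ momentRatio γ h (n + 1) / momentRatio γ h n - 1 with hv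
  have hv0 : Tendsto v atTop (𝓝 0) := by
    simpa using (tendsto_momentRatio_succ_div hh hγ hα0 hα1).sub_const 1
  have hs : Tendsto (fun n ↦ √|v n|) atTop (𝓝 0) := by simpa using hv0.abs.sqrt
  -- the choice `ε = √|v|`, with a summand that keeps `ε` positive when the variance vanishes
  have hε : Tendsto (fun n : ℕ ↦ √|v n| + 1 / ((n : ℝ) + 1)) atTop (𝓝 0) := by
    simpa using hs.add tendsto_one_div_add_atTop_nhds_zero_nat
  have hlim := (hε.add hs).const_mul (2 * ‖z‖ + 4)
  rw [add_zero, mul_zero] at hlim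
  refine squeeze_zero (fun _ ↦ norm_nonneg _) (fun n ↦ ?_) hlim
  have hpos : 0 < √|v n| + 1 / ((n : ℝ) + 1) := by positivity
  refine (norm_moment_div_sub_one_le hh hγ hα0 hα1 hz0 hz1 n hpos).trans ?_
  gcongr
  rw [div_le_iff₀ hpos]
  have h1 : √|v n| * √|v n| = |v n| := Real.mul_self_sqrt (abs_nonneg _)
  have h2 : 0 ≤ √|v n| * (1 / ((n : ℝ) + 1)) := by positivity
  change v n ≤ _
  linarith [le_abs_self (v n)]

/-- The recurrence of the moments iterated `n` times. -/
lemma prod_mul_moment (hh : IsDensity γ α h) (hγ : 0 < γ) (hα0 : 0 ≤ α) (hα1 : α < 1) {z : ℂ}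
    (hz : -1 < z.re) (n : ℕ) : (∏ k ∈ Finset.range n, (z + 1 + k)) * moment γ h z =
      (∏ k ∈ Finset.range n, F γ α (k + 1 + z)) * moment γ h (n + z) := by
  induction n with
  | zero => simp
  | succ n ih =>
    have h1 := moment_recurrence hh hγ hα0 hα1 (z := n + z) (by
      simp; linarith [Nat.cast_nonneg (α := ℝ) n])
    rw [Finset.prod_range_succ, Finset.prod_range_succ, mul_right_comm, ih]
    push_cast
    rw [show (n : ℂ) + 1 + z = n + z + 1 by ring, mul_assoc _ (F γ α _), ← h1]
    ring

/-- The moments with exponent in the strip `0 ≤ Re z ≤ 1`, by Euler's limit formula for `Γ`. -/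
lemma moment_eq_of_re_mem (hh : IsDensity γ α h) (hγ : 0 < γ) (hα0 : 0 ≤ α) (hα1 : α < 1)
    {z : ℂ} (hz0 : 0 ≤ z.re) (hz1 : z.re ≤ 1) :
    moment γ h z = Gamma (z + 1) * growthFactor γ α (-z) := by
  have hp : 0 < 1 - α := by linarith
  have hz : -1 < z.re := by linarith
  have hne : ∀ k : ℕ, z + 1 + k ≠ 0 := fun k h0 ↦ by
    have := congrArg re h0
    simp at this
    linarith [Nat.cast_nonneg (α := ℝ) k]
  have hF : ∀ k : ℕ, F γ α ((k : ℂ) + 1) ≠ 0 := fun k ↦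
    F_ne_zero hγ hα0 hα1 (by simp; positivity)
  have hw : ∀ n, (natMoment γ h n : ℂ) ≠ 0 := fun n ↦ by
    exact_mod_cast (natMoment_pos hh hγ hα0 hα1 n).ne'
  have hfac : ∀ n : ℕ, (n.factorial : ℂ) =
      (∏ k ∈ Finset.range n, F γ α ((k : ℂ) + 1)) * natMoment γ h n := by
    intro n
    have := prod_mul_moment hh hγ hα0 hα1 (z := 0) (by simp) n
    simp only [zero_add, add_zero, moment_zero hh, mul_one, moment_natCast] at this
    rw [← this, ← Finset.prod_range_add_one_eq_factorial]
    push_cast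
    exact Finset.prod_congr rfl fun k _ ↦ add_comm _ _
  have hlim1 := (multipliable_ratio hγ hα0 hα1 (-z)).hasProd.tendsto_prod_nat
  have hlim2 := GammaSeq_tendsto_Gamma (z + 1)
  have hlim3 : Tendsto (fun n : ℕ ↦ ((n : ℂ) + (z + 1)) / n) atTop (𝓝 1) := by
    have h1 : Tendsto (fun n : ℕ ↦ 1 + (z + 1) * (n : ℂ)⁻¹) atTop (𝓝 (1 + (z + 1) * 0)) :=
      (tendsto_inv_atTop_nhds_zero_nat (𝕜 := ℂ)).const_mul (z + 1) |>.const_add 1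
    rw [mul_zero, add_zero] at h1
    refine h1.congr' ?_
    filter_upwards [eventually_ne_atTop 0] with n hn
    have : (n : ℂ) ≠ 0 := by exact_mod_cast hn
    field_simp
  have hlim4 := tendsto_moment_div hh hγ hα0 hα1 hz0 hz1
  have hlim5 : Tendsto (fun n : ℕ ↦ ((momentRatio γ h n / n : ℝ) : ℂ) ^ z) atTop
      (𝓝 (((1 - α : ℝ) : ℂ) ^ (γ * z))) := by
    rw [cpow_mul_ofReal_nonneg hp.le]
    refine Tendsto.cpow ?_ tendsto_const_nhds ?_
    · exact (continuous_ofReal.tendsto _).comp (tendsto_momentRatio_div hh hγ hα0 hα1)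
    · exact Or.inl (by rw [ofReal_re]; positivity)
  have hlim := (((hlim1.mul hlim2).mul hlim3).mul hlim4).mul hlim5
  have hconst : ∀ᶠ n : ℕ in atTop, (∏ k ∈ Finset.range n, ratio γ α (-z) k) *
      GammaSeq (z + 1) n * (((n : ℂ) + (z + 1)) / n) *
      (moment γ h (n + z) / (natMoment γ h n * (momentRatio γ h n : ℂ) ^ z)) *
      ((momentRatio γ h n / n : ℝ) : ℂ) ^ z = moment γ h z := by
    filter_upwards [eventually_ne_atTop 0] with n hn
    have hn0 : (n : ℂ) ≠ 0 := by exact_mod_cast hn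
    have hm0 := momentRatio_pos hh hγ hα0 hα1 n
    have hnpos : (0 : ℝ) < n := by exact_mod_cast Nat.pos_of_ne_zero hn
    have hpow : (momentRatio γ h n : ℂ) ^ z =
        ((momentRatio γ h n / n : ℝ) : ℂ) ^ z * (n : ℂ) ^ z := by
      conv_lhs => rw [← div_mul_cancel₀ (momentRatio γ h n) hnpos.ne', ofReal_mul,
        mul_cpow_ofReal_nonneg (by positivity) hnpos.le, ofReal_natCast]
    have h1 : ((momentRatio γ h n / n : ℝ) : ℂ) ^ z ≠ 0 := by
      rw [Ne, cpow_eq_zero_iff, not_and_or]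
      exact Or.inl (by exact_mod_cast (div_pos hm0 hnpos).ne')
    have h2 : (n : ℂ) ^ z ≠ 0 := by
      rw [Ne, cpow_eq_zero_iff, not_and_or]; exact Or.inl hn0
    have h3 : ∏ k ∈ Finset.range n, (z + 1 + (k : ℂ)) ≠ 0 :=
      Finset.prod_ne_zero_iff.2 fun k _ ↦ hne k
    have h4 : ∏ k ∈ Finset.range n, F γ α ((k : ℂ) + 1) ≠ 0 :=
      Finset.prod_ne_zero_iff.2 fun k _ ↦ hF k
    have h5 := prod_mul_moment hh hγ hα0 hα1 hz n
    have h6 : ∏ k ∈ Finset.range n, ratio γ α (-z) k =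
        (∏ k ∈ Finset.range n, F γ α ((k : ℂ) + 1 + z)) /
          ∏ k ∈ Finset.range n, F γ α ((k : ℂ) + 1) := by
      rw [← Finset.prod_div_distrib]
      simp only [ratio, sub_neg_eq_add]
    have h7 : (n : ℂ) + (z + 1) = z + 1 + n := add_comm _ _
    have h8 := hne n
    have h9 := hw n
    rw [GammaSeq, Finset.prod_range_succ, cpow_add _ _ hn0, cpow_one, hpow, h6, h7, hfac n]
    rw [← mul_right_inj' h3, h5]
    field_simp
  have hfinal := tendsto_nhds_unique (tendsto_const_nhds.congr' (hconst.mono fun n hn ↦ hn.symm))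
    hlim
  rw [hfinal, growthFactor, mul_neg, neg_neg]
  ring

/-- The moments of a solution are determined by the integral equation and the normalisation. -/
lemma moment_eq (hh : IsDensity γ α h) (hγ : 0 < γ) (hα0 : 0 ≤ α) (hα1 : α < 1)
    {z : ℂ} (hz : -1 < z.re) : moment γ h z = Gamma (z + 1) * growthFactor γ α (-z) := by
  have hne : ∀ z : ℂ, -1 < z.re → z + 1 ≠ 0 := fun z hz h0 ↦ by
    have := congrArg re h0
    simp at this
    linarith
  -- both sides satisfy the same functional equation
  have hrec : ∀ z : ℂ, -1 < z.re → (z + 1) * (Gamma (z + 1) * growthFactor γ α (-z)) =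
      F γ α (z + 1) * (Gamma (z + 1 + 1) * growthFactor γ α (-(z + 1))) := by
    intro z hz
    rw [Gamma_add_one _ (hne z hz), growthFactor_eq hγ hα0 hα1 (-z),
      show -z - 1 = -(z + 1) by ring, show 1 - -z = z + 1 by ring]
    ring
  have hright : ∀ (k : ℕ) (z : ℂ), 0 ≤ z.re → z.re ≤ k + 1 →
      moment γ h z = Gamma (z + 1) * growthFactor γ α (-z) := by
    intro k
    induction k with
    | zero => intro z h0 h1; exact moment_eq_of_re_mem hh hγ hα0 hα1 h0 (by simpa using h1)
    | succ k ih =>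
      intro z h0 h1
      push_cast at h1
      rcases le_total z.re 1 with h2 | h2
      · exact moment_eq_of_re_mem hh hγ hα0 hα1 h0 h2
      · have h3 := ih (z - 1) (by simpa using h2) (by simp; linarith)
        have h4 : -1 < (z - 1).re := by simp; linarith
        have h5 := moment_recurrence hh hγ hα0 hα1 h4
        rw [h3, hrec _ h4, sub_add_cancel] at h5
        exact (mul_left_cancel₀ (F_ne_zero hγ hα0 hα1 h0) h5).symm
  rcases le_total 0 z.re with h0 | h0
  · obtain ⟨k, hk⟩ := exists_nat_ge z.re
    exact hright k z h0 (by linarith)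
  · have h1 := hright 0 (z + 1) (by simp; linarith) (by simp; linarith)
    have h2 := moment_recurrence hh hγ hα0 hα1 hz
    rw [h1, ← hrec z hz] at h2
    exact mul_left_cancel₀ (hne z hz) h2

end

/-! ### Explicit formulas for the density -/

section

variable {γ α : ℝ} {h : ℝ → ℝ}

lemma ratioH_eq_ratio (hγ : 0 < γ) (s : ℂ) : ratioH γ α s = ratio γ α (-((1 - s) / γ)) := by
  have hγ0 : (γ : ℂ) ≠ 0 := by exact_mod_cast hγ.ne'
  ext j
  have h1 : 1 - s + ((j : ℂ) + 1) * γ = ((j : ℂ) + 1 - -((1 - s) / γ)) * γ := by field_simp; ring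
  have h2 : 2 - s + ((j : ℂ) + 1) * γ = 1 + ((j : ℂ) + 1 - -((1 - s) / γ)) * γ := by
    rw [← h1]; ring
  rw [ratioH, ratio, h1, h2, F_eq_hyp γ α ((j : ℂ) + 1 - -((1 - s) / γ)), hyp]

/-- The Mellin transform of the density is its moment function in the variable `(1 - s) / γ`. -/
lemma hasMellin_density (hh : IsDensity γ α h) (hγ : 0 < γ) (hα0 : 0 ≤ α) (hα1 : α < 1) {s : ℂ}
    (hs : s.re < 1 + γ) : HasMellin (fun x : ℝ ↦ (h x : ℂ)) s
      (((1 - α : ℝ) : ℂ) ^ (1 - s) * Gamma ((1 + γ - s) / γ) * ∏' j : ℕ, ratioH γ α s j) := by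
  have hγ0 : (γ : ℂ) ≠ 0 := by exact_mod_cast hγ.ne'
  refine ⟨hh.mellinConvergent hγ hα0 hα1 hs, ?_⟩
  have hz : -1 < ((1 - s) / γ : ℂ).re := by
    rw [div_ofReal_re, lt_div_iff₀ hγ]
    simp only [sub_re, one_re]
    linarith
  have h1 := moment_eq hh hγ hα0 hα1 hz
  have e1 : (1 : ℂ) - γ * ((1 - s) / γ) = s := by field_simp; ring
  have e2 : (1 - s) / γ + 1 = (1 + γ - s) / (γ : ℂ) := by field_simp; ring
  have e3 : -((γ : ℂ) * -((1 - s) / γ)) = 1 - s := by field_simp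
  rw [moment, e1, e2, growthFactor, e3, ← ratioH_eq_ratio hγ] at h1
  rw [h1]
  ring

lemma hIntegrand_eq (γ α x : ℝ) (t : ℂ) : hIntegrand γ α x t =
    (x : ℂ) ^ (-(γ * t)) * (Gamma (1 - t) * growthFactor γ α t) := by
  rw [hIntegrand, growthFactor]
  ring

lemma verticalIntegrable_hIntegrand (hγ : 0 < γ) (hα0 : 0 ≤ α) (hα1 : α < 1) {x : ℝ}
    (hx : 0 < x) {c : ℝ} (hc : c < 1) : VerticalIntegrable (hIntegrand γ α x) c := by
  have h1γ : 0 < 1 / γ := by positivity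
  obtain ⟨C, hC0, hC⟩ := exists_norm_Gamma_mul_growthFactor_le hγ hα0 hα1 (1 - c) (1 - c) c
    (b := c) (by linarith)
  refine integrable_of_norm_le_div_sq (C := x ^ (-(γ * c)) * C) ?_ fun y hy ↦ ?_
  · refine continuous_comp_line (s := {t | t.re < 1}) ?_ fun t ht ↦ by
      rw [Set.mem_ofPred_eq, ht]; exact hc
    refine ContinuousOn.congr ?_ fun t _ ↦ hIntegrand_eq γ α x t
    refine DifferentiableOn.continuousOn (𝕜 := ℂ) (DifferentiableOn.mul ?_
      (DifferentiableOn.mul ?_ ?_))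
    · exact DifferentiableOn.const_cpow (by fun_prop) (Or.inl (by exact_mod_cast hx.ne'))
    · intro t ht
      refine DifferentiableAt.differentiableWithinAt ?_
      refine (differentiableAt_Gamma (1 - t) fun m h ↦ ?_).comp t (f := fun t : ℂ ↦ 1 - t)
        (by fun_prop)
      have h1 : t.re < 1 := ht
      have h2 := congrArg re h
      simp at h2
      linarith [Nat.cast_nonneg (α := ℝ) m]
    · refine (differentiableOn_growthFactor hγ hα0 hα1).mono fun t ht ↦ ?_
      have h1 : t.re < 1 := ht
      simp only [Set.mem_ofPred_eq]
      linarith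
  · rw [hIntegrand_eq, norm_mul, norm_cpow_eq_rpow_re_of_pos hx, mul_div_assoc]
    refine mul_le_mul (le_of_eq (by simp)) ?_ (norm_nonneg _) (by positivity)
    simpa using hC (c + y * I) (1 - (c + y * I)) (by simp) (by simp) (by simp) (by simp) (by simp)
      (by simpa using hy)

/-- Mellin inversion on the line `Re s = 1 + γ c`, rescaled to the line `Re t = c` by
`s = 1 + γ t`. -/
lemma density_eq_lineIntegral (hh : IsDensity γ α h) (hγ : 0 < γ) (hα0 : 0 ≤ α) (hα1 : α < 1)
    {x : ℝ} (hx : 0 < x) {c : ℝ} (hc : c < 1) :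
    (h x : ℂ) = γ / (2 * (Real.pi : ℂ) * I * x) * lineIntegral c (hIntegrand γ α x) := by
  have hγ0 : (γ : ℂ) ≠ 0 := by exact_mod_cast hγ.ne'
  have hx0 : (x : ℂ) ≠ 0 := by exact_mod_cast hx.ne'
  have hpi : (Real.pi : ℂ) ≠ 0 := by exact_mod_cast Real.pi_ne_zero
  set σ : ℝ := 1 + γ * c with hσ
  have hmellin : ∀ (x y : ℝ), 0 < x →
      (x : ℂ) ^ (-(σ + y * I)) * mellin (fun x ↦ (h x : ℂ)) (σ + y * I) =
        (x : ℂ)⁻¹ * hIntegrand γ α x (c + (y / γ : ℝ) * I) := by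
    intro x y hx
    have hx0 : (x : ℂ) ≠ 0 := by exact_mod_cast hx.ne'
    have h1 := moment_eq hh hγ hα0 hα1 (z := -(c + (y / γ : ℝ) * I)) (by simpa using hc)
    have e1 : (1 : ℂ) - γ * -(c + (y / γ : ℝ) * I) = σ + y * I := by
      rw [hσ]; push_cast; field_simp; ring
    rw [moment, e1, neg_neg, neg_add_eq_sub] at h1
    rw [h1, hIntegrand_eq, ← cpow_neg_one, ← mul_assoc ((x : ℂ) ^ (-1 : ℂ)),
      ← cpow_add _ _ hx0]
    congr 2
    rw [hσ]; push_cast; field_simp; ring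
  have hvert : VerticalIntegrable (mellin fun x ↦ (h x : ℂ)) σ := by
    have h1 := (verticalIntegrable_hIntegrand hγ hα0 hα1 one_pos hc).comp_div hγ.ne'
    refine Integrable.congr h1 (Eventually.of_forall fun y ↦ ?_)
    simpa using (hmellin 1 y one_pos).symm
  have hcont : ContinuousAt (fun x ↦ (h x : ℂ)) x :=
    continuous_ofReal.continuousAt.comp
      ((hh.continuousOn hγ hα0 hα1).continuousAt (Ioi_mem_nhds hx))
  have hinv := mellinInv_mellin_eq σ (fun x ↦ (h x : ℂ)) hx
    (hh.mellinConvergent hγ hα0 hα1 (by simp [hσ]; nlinarith)) hvert hcont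
  rw [← hinv, mellinInv]
  simp only [smul_eq_mul, hmellin x _ hx]
  rw [integral_const_mul, Measure.integral_comp_div
    (fun y : ℝ ↦ hIntegrand γ α x (c + (y : ℂ) * I)) γ, abs_of_pos hγ, lineIntegral,
    integral_mul_const, real_smul, real_smul]
  generalize (∫ y : ℝ, hIntegrand γ α x (c + (y : ℂ) * I)) = J
  push_cast
  field_simp

end

end AlphaSun

end

theorem proposition3 (γ α : ℝ) (hγ : 0 < γ) (hα0 : 0 ≤ α) (hα1 : α < 1) :
    -- the infinite product converges to the left of its first pole
    (∀ t : ℂ, t.re < 1 + 1 / γ → Multipliable (AlphaSun.ratio γ α t)) ∧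
    -- the generating function
    (∀ x : ℂ, Summable (AlphaSun.gTerm γ α x)) ∧
    (∀ x : ℝ, 0 < x → ∀ c : ℝ, 0 < c → c < 1 + 1 / γ →
      Complex.VerticalIntegrable (AlphaSun.gIntegrand γ α x) c ∧
      AlphaSun.g γ α (x : ℂ) =
        1 / (2 * (Real.pi : ℂ) * Complex.I) *
          AlphaSun.lineIntegral c (AlphaSun.gIntegrand γ α x)) ∧
    -- the density and its Mellin transform
    (∀ h : ℝ → ℝ, AlphaSun.IsDensity γ α h →
      (∀ x : ℝ, 0 < x → ∀ c : ℝ, c < 1 →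
        Complex.VerticalIntegrable (AlphaSun.hIntegrand γ α x) c ∧
        (h x : ℂ) =
          (γ : ℂ) / (2 * (Real.pi : ℂ) * Complex.I * (x : ℂ)) *
            AlphaSun.lineIntegral c (AlphaSun.hIntegrand γ α x)) ∧
      (∀ s : ℂ, s.re < 1 + γ →
        Multipliable (AlphaSun.ratioH γ α s) ∧
        HasMellin (fun x : ℝ => (h x : ℂ)) s
          (((1 - α : ℝ) : ℂ) ^ (1 - s) * Complex.Gamma ((1 + γ - s) / γ) *
            ∏' j : ℕ, AlphaSun.ratioH γ α s j))) := by
  refine ⟨fun t _ ↦ AlphaSun.multipliable_ratio hγ hα0 hα1 t,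
    AlphaSun.summable_gTerm hγ hα0 hα1,
    fun x hx c hc0 hc ↦ ⟨AlphaSun.verticalIntegrable_gIntegrand hγ hα0 hα1 hx hc0 hc,
      AlphaSun.g_eq_lineIntegral hγ hα0 hα1 hx hc0 hc⟩,
    fun h hh ↦ ⟨fun x hx c hc ↦ ⟨AlphaSun.verticalIntegrable_hIntegrand hγ hα0 hα1 hx hc,
      AlphaSun.density_eq_lineIntegral hh hγ hα0 hα1 hx hc⟩, fun s hs ↦ ⟨?_,
      AlphaSun.hasMellin_density hh hγ hα0 hα1 hs⟩⟩⟩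
  rw [AlphaSun.ratioH_eq_ratio hγ]
  exact AlphaSun.multipliable_ratio hγ hα0 hα1 _
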